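/- For a finite-dimensional real Lie algebra $\mathfrak g$ let $d\colon\mathfrak g^*\to\Lambda^2\mathfrak g^*$ be given by $(d\sigma)(X,Y)=-\sigma([X,Y])$, and let $b_1=\dim\ker d$ be its first Betti number. A complex structure on $\mathfrak g$ is a linear map $J\colon\mathfrak g\to\mathfrak g$ with $J^2=-1$ and $[JX,JY]=[X,Y]+J[JX,Y]+J[X,JY]$ for all $X,Y\in\mathfrak g$; its space $\Lambda^{1,0}$ of $(1,0)$-forms is the complex subspace of $\mathfrak g^*\otimes\mathbb C$ consisting of the $\sigma$ with $\sigma\circ J=i\,\sigma$. The symbol $(0,0,0,de^4,de^5,de^6)$ denotes the 6-dimensional real Lie algebra whose dual has a basis $e^1,\dots,e^6$ with $de^1=de^2=de^3=0$ and the indicated $de^4,de^5,de^6$, where $jk$ abbreviates $e^j\wedge e^k$. **Theorem 3.2.** Let $\mathfrak g$ be a 6-dimensional real nilpotent Lie algebra with $b_1=3$ that admits a complex structure. Then $\mathfrak g$ is isomorphic to one of the following nine Lie algebras: 1. $(0,0,0,12,13,14)$, 2. $(0,0,0,12,13,23)$, 3. $(0,0,0,12,14,24)$, 4. $(0,0,0,12,13,24)$,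 5. $(0,0,0,12,13+14,24)$, 6. $(0,0,0,12,13,14+23)$, 7. $(0,0,0,12,14,13+42)$, 8. $(0,0,0,12,13+42,14+23)$, 9. $(0,0,0,12,23,14-35)$. Conversely, each of these nine algebras is nilpotent of dimension 6 with $b_1=3$ and admits a complex structure. More precisely: each of the algebras 1–5 has a complex structure with $\Lambda^{1,0}=\langle e^1+ie^2,\ e^3+be^4,\ e^5+ce^6\rangle$ for some $b,c\in\mathbb C$; each of the algebras 6–8 has a complex structure with $\Lambda^{1,0}=\langle e^1+ae^2,\ e^3+be^4,\ e^5+ie^6\rangle$ for some $a,b\in\mathbb C$; and algebra 9 has a complex structure with $\Lambda^{1,0}=\langle e^1+ie^3,\ e^4-ie^5,\ e^2+ie^6\rangle$. -/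

import Mathlib

noncomputable section

namespace NilpotentComplex

/-! ### Forms on a real Lie algebra -/

section Forms

variable (g : Type*) [LieRing g] [LieAlgebra ℝ g]

/-- The first differential `d : g* → Λ² g*` of the Chevalley–Eilenberg complex of `g` with trivial
real coefficients, `(dσ)(X, Y) = -σ([X, Y])`; 2-forms are written as bilinear maps. -/
def extD : Module.Dual ℝ g →ₗ[ℝ] (g →ₗ[ℝ] g →ₗ[ℝ] ℝ) where
  toFun σ := LinearMap.mk₂ ℝ (fun X Y : g => -σ ⁅X, Y⁆)
    (by intro X X' Y; simp only [add_lie, map_add, neg_add])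
    (by intro c X Y; simp only [smul_lie, map_smul, smul_neg])
    (by intro X Y Y'; simp only [lie_add, map_add, neg_add])
    (by intro c X Y; simp only [lie_smul, map_smul, smul_neg])
  map_add' σ τ := by
    ext X Y
    simp only [LinearMap.mk₂_apply, LinearMap.add_apply, neg_add]
  map_smul' c σ := by
    ext X Y
    simp only [LinearMap.mk₂_apply, LinearMap.smul_apply, smul_neg, RingHom.id_apply]

/-- The first Betti number `b₁ = dim H¹(g) = dim ker (d : g* → Λ² g*)`.  (The differential from
degree `0` vanishes for trivial coefficients.) -/
def firstBetti : ℕ := Module.finrank ℝ (LinearMap.ker (extD g))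

variable {g}

/-- `J` is an (integrable) complex structure on the Lie algebra `g`: `J² = -1` and
`[JX, JY] = [X, Y] + J[JX, Y] + J[X, JY]`. -/
structure IsComplexStructure (J : g →ₗ[ℝ] g) : Prop where
  sq : ∀ X : g, J (J X) = -X
  integrable : ∀ X Y : g, ⁅J X, J Y⁆ = ⁅X, Y⁆ + J ⁅J X, Y⁆ + J ⁅X, J Y⁆

/-- The space `Λ^{1,0}` of `(1,0)`-forms of `J`, inside the complexified dual of `g` (real-linear
maps from `g` to `ℂ`): the complex-valued 1-forms `σ` with `σ ∘ J = i σ`. -/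
def formsOneZero (J : g →ₗ[ℝ] g) : Submodule ℂ (g →ₗ[ℝ] ℂ) where
  carrier := {σ | ∀ X : g, σ (J X) = Complex.I * σ X}
  add_mem' {σ τ} hσ hτ X := by
    simp only [LinearMap.add_apply, hσ X, hτ X, mul_add]
  zero_mem' X := by simp only [LinearMap.zero_apply, mul_zero]
  smul_mem' c σ hσ X := by
    simp only [LinearMap.smul_apply, hσ X, smul_eq_mul]; ring

variable (g) in
/-- The Lie algebra `g` admits a complex structure. -/
def AdmitsComplexStructure : Prop := ∃ J : g →ₗ[ℝ] g, IsComplexStructure J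

end Forms

/-! ### The nine Lie algebras

Coordinates on `ℝ⁶` are indexed by `Fin 6`, so that `e¹, …, e⁶` are the coordinates
number `0, …, 5`. -/

/-- The 2-form `u ∧ v` on `ℝ⁶`, where `u`, `v` are the coordinates with (zero-based) indices
`i`, `j`: `(u ∧ v)(X, Y) = u(X) v(Y) - u(Y) v(X)`. -/
def wedge (i j : Fin 6) : (Fin 6 → ℝ) →ₗ[ℝ] (Fin 6 → ℝ) →ₗ[ℝ] ℝ :=
  LinearMap.mk₂ ℝ (fun X Y => X i * Y j - Y i * X j)
    (by intro X X' Y; simp only [Pi.add_apply]; ring)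
    (by intro c X Y; simp only [Pi.smul_apply, smul_eq_mul]; ring)
    (by intro X Y Y'; simp only [Pi.add_apply]; ring)
    (by intro c X Y; simp only [Pi.smul_apply, smul_eq_mul]; ring)

/-- `e¹ ∧ e²`. -/
def e12 : (Fin 6 → ℝ) →ₗ[ℝ] (Fin 6 → ℝ) →ₗ[ℝ] ℝ := wedge 0 1
/-- `e¹ ∧ e³`. -/
def e13 : (Fin 6 → ℝ) →ₗ[ℝ] (Fin 6 → ℝ) →ₗ[ℝ] ℝ := wedge 0 2
/-- `e¹ ∧ e⁴`. -/
def e14 : (Fin 6 → ℝ) →ₗ[ℝ] (Fin 6 → ℝ) →ₗ[ℝ] ℝ := wedge 0 3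
/-- `e² ∧ e³`. -/
def e23 : (Fin 6 → ℝ) →ₗ[ℝ] (Fin 6 → ℝ) →ₗ[ℝ] ℝ := wedge 1 2
/-- `e² ∧ e⁴`. -/
def e24 : (Fin 6 → ℝ) →ₗ[ℝ] (Fin 6 → ℝ) →ₗ[ℝ] ℝ := wedge 1 3
/-- `e³ ∧ e⁵`. -/
def e35 : (Fin 6 → ℝ) →ₗ[ℝ] (Fin 6 → ℝ) →ₗ[ℝ] ℝ := wedge 2 4
/-- `e⁴ ∧ e²`. -/
def e42 : (Fin 6 → ℝ) →ₗ[ℝ] (Fin 6 → ℝ) →ₗ[ℝ] ℝ := wedge 3 1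

/-- The nine tuples `(de¹, …, de⁶)`. -/
def structureForms : Fin 9 → Fin 6 → (Fin 6 → ℝ) →ₗ[ℝ] (Fin 6 → ℝ) →ₗ[ℝ] ℝ :=
  ![![0, 0, 0, e12, e13, e14],
    ![0, 0, 0, e12, e13, e23],
    ![0, 0, 0, e12, e14, e24],
    ![0, 0, 0, e12, e13, e24],
    ![0, 0, 0, e12, e13 + e14, e24],
    ![0, 0, 0, e12, e13, e14 + e23],
    ![0, 0, 0, e12, e14, e13 + e42],
    ![0, 0, 0, e12, e13 + e42, e14 + e23],
    ![0, 0, 0, e12, e23, e14 - e35]]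

theorem wedge_apply (i j : Fin 6) (X Y : Fin 6 → ℝ) :
    wedge i j X Y = X i * Y j - Y i * X j := rfl

theorem structureForms_self (n : Fin 9) (k : Fin 6) (X : Fin 6 → ℝ) :
    structureForms n k X X = 0 := by
  fin_cases n <;> fin_cases k <;>
    simp [structureForms, e12, e13, e14, e23, e24, e35, e42, wedge_apply]

theorem structureForms_jacobi (n : Fin 9) (k : Fin 6) (X Y Z : Fin 6 → ℝ) :
    structureForms n k X (fun l => -structureForms n l Y Z) =
      structureForms n k (fun l => -structureForms n l X Y) Z +
        structureForms n k Y (fun l => -structureForms n l X Z) := by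
  fin_cases n <;> fin_cases k <;>
    simp [structureForms, e12, e13, e14, e23, e24, e35, e42, wedge_apply] <;> ring

/-- The `n`-th of the nine Lie algebras: the vector space `ℝ⁶` with the bracket that is determined
by `eᵏ([X, Y]) = -(deᵏ)(X, Y)` and the `n`-th tuple `(de¹, …, de⁶)`. -/
def ListedAlgebra (_n : Fin 9) : Type := Fin 6 → ℝ

instance (n : Fin 9) : AddCommGroup (ListedAlgebra n) := inferInstanceAs (AddCommGroup (Fin 6 → ℝ))

instance (n : Fin 9) : Module ℝ (ListedAlgebra n) := inferInstanceAs (Module ℝ (Fin 6 → ℝ))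

instance (n : Fin 9) : Bracket (ListedAlgebra n) (ListedAlgebra n) where
  bracket X Y := fun k => -structureForms n k X Y

theorem listed_bracket_apply (n : Fin 9) (X Y : ListedAlgebra n) (k : Fin 6) :
    (⁅X, Y⁆ : ListedAlgebra n) k = -structureForms n k X Y := rfl

theorem listed_add_apply (n : Fin 9) (X Y : ListedAlgebra n) (k : Fin 6) :
    (X + Y : ListedAlgebra n) k = X k + Y k := rfl

theorem listed_smul_apply (n : Fin 9) (c : ℝ) (X : ListedAlgebra n) (k : Fin 6) :
    (c • X : ListedAlgebra n) k = c * X k := rfl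

theorem listed_zero_apply (n : Fin 9) (k : Fin 6) : (0 : ListedAlgebra n) k = 0 := rfl

instance (n : Fin 9) : LieRing (ListedAlgebra n) where
  add_lie X Y Z := by
    funext k
    have h : structureForms n k (X + Y) Z = structureForms n k X Z + structureForms n k Y Z :=
      LinearMap.map_add₂ (structureForms n k) X Y Z
    simp only [listed_bracket_apply, listed_add_apply, h, neg_add]
  lie_add X Y Z := by
    funext k
    have h : structureForms n k X (Y + Z) = structureForms n k X Y + structureForms n k X Z :=
      map_add (structureForms n k X) Y Z
    simp only [listed_bracket_apply, listed_add_apply, h, neg_add]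
  lie_self X := by
    funext k
    simp only [listed_bracket_apply, listed_zero_apply, structureForms_self n k X, neg_zero]
  leibniz_lie X Y Z := by
    funext k
    rw [listed_add_apply]
    exact (congrArg Neg.neg (structureForms_jacobi n k X Y Z)).trans (neg_add _ _)

instance (n : Fin 9) : LieAlgebra ℝ (ListedAlgebra n) where
  lie_smul c X Y := by
    funext k
    have h : structureForms n k X (c • Y) = c * structureForms n k X Y :=
      map_smul (structureForms n k X) c Y
    simp only [listed_bracket_apply, listed_smul_apply, h, mul_neg]

/-- The `k`-th coordinate 1-form (zero-based: `k = 0, …, 5` give `e¹, …, e⁶`) on the `n`-th listed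
algebra, as an element of the complexified dual. -/
def coframe (n : Fin 9) (k : Fin 6) : ListedAlgebra n →ₗ[ℝ] ℂ where
  toFun X := ((X k : ℝ) : ℂ)
  map_add' X Y := by rw [listed_add_apply, Complex.ofReal_add]
  map_smul' c X := by
    rw [listed_smul_apply, Complex.ofReal_mul, RingHom.id_apply, Complex.real_smul]

/-- The complex subspace `⟨e¹ + a e², e³ + b e⁴, e⁵ + c e⁶⟩` of the complexified dual. -/
def spanL (n : Fin 9) (a b c : ℂ) : Submodule ℂ (ListedAlgebra n →ₗ[ℝ] ℂ) :=
  Submodule.span ℂ {coframe n 0 + a • coframe n 1, coframe n 2 + b • coframe n 3,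
    coframe n 4 + c • coframe n 5}

/-- The complex subspace `⟨e¹ + i e³, e⁴ - i e⁵, e² + i e⁶⟩` of the complexified dual. -/
def spanM (n : Fin 9) : Submodule ℂ (ListedAlgebra n →ₗ[ℝ] ℂ) :=
  Submodule.span ℂ {coframe n 0 + Complex.I • coframe n 2, coframe n 3 - Complex.I • coframe n 4,
    coframe n 1 + Complex.I • coframe n 5}

end NilpotentComplex

end

noncomputable section

namespace NilpotentComplex

open LieModule Module

/-! ### The lower central series and the first Betti number. -/

section LowerCentralSeries

variable {g : Type*} [LieRing g] [LieAlgebra ℝ g]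

/-! Write g' = [g, g], g'' = [g, g'], K = g' + Jg' and L = g' ∩ Jg'. Closed 1-forms are the
annihilator of g', so b₁ = 3 means dim g' = 3. If K were all of g, integrability would propagate
this equality down the lower central series, contradicting nilpotency (`sup_map_ne_top`). As K and L
are J-invariant, hence even-dimensional, dim K = 4 and dim L = 2 (`finrank_sup_map_and_inf_map`).
This gives a J-invariant flag L ⊂ K ⊂ g with two-dimensional steps, and the proof splits on whether
g'' lies in L.

If g'' ⊆ L, then L is central (`lie_eq_zero_of_lcSub_two_le`) and [g, K] ⊆ L. For T outside K put B
= [T, JT], and let n ≠ 0 lie in L. In the frame T, JT, JB, B, n, Jn the structure equations become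
(0, 0, 0, 12, M, N) up to sign, where M and N are independent elements of ⟨e¹, e²⟩ ∧ ⟨e³, e⁴⟩, that
is, a pencil of 2×2 matrices. The allowed changes of basis are arbitrary on ⟨e¹, e²⟩ but must
preserve the line of the closed form e³, so they act on ⟨e³, e⁴⟩ by triangular matrices.
`HasPencil.exists_nonempty_equiv` finds the normal forms: a pencil with a rank-one element gives one
of the algebras 1–7, and a pencil on which the determinant is definite gives algebra 8.

If g'' is not contained in L, it is a central line spanned by some n with Jn outside g'
(`lcSub_two_le_span`). Then ad(·)(Jn) takes values in L, and for b = [T, Jn] the vectors T, JT, Jn,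
b, Jb, n form a frame. Integrability and the Jacobi identity fix the brackets up to [T, JT] and one
nonzero scalar, which a change of coframe normalises to algebra 9 (`nonempty_equiv_of_frame`).

The converse is a computation in coordinates: the first eight algebras carry structures `blockJ`
that preserve three coordinate planes, the ninth carries `lastJ`. -/

theorem lowerCentralSeries_succ_le_iff (k : ℕ) (S : Submodule ℝ g) :
    (lowerCentralSeries ℝ g g (k + 1)).toSubmodule ≤ S ↔
      ∀ X : g, ∀ Y ∈ lowerCentralSeries ℝ g g k, ⁅X, Y⁆ ∈ S := by
  rw [lowerCentralSeries_succ, LieSubmodule.lieIdeal_oper_eq_linear_span', Submodule.span_le]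
  constructor
  · intro h X Y hY
    exact h ⟨X, LieSubmodule.mem_top X, Y, hY, rfl⟩
  · rintro h _ ⟨X, -, Y, hY, rfl⟩
    exact h X Y hY

theorem lie_mem_lowerCentralSeries_succ {k : ℕ} (X : g) {Y : g}
    (hY : Y ∈ lowerCentralSeries ℝ g g k) : ⁅X, Y⁆ ∈ lowerCentralSeries ℝ g g (k + 1) :=
  (lowerCentralSeries_succ_le_iff k _).1 le_rfl X Y hY

theorem lie_mem_lowerCentralSeries_one (X Y : g) : ⁅X, Y⁆ ∈ lowerCentralSeries ℝ g g 1 :=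
  lie_mem_lowerCentralSeries_succ X (by simp)

theorem mem_ker_extD_iff (σ : Dual ℝ g) :
    σ ∈ LinearMap.ker (extD g) ↔ ∀ X Y : g, σ ⁅X, Y⁆ = 0 := by
  rw [LinearMap.mem_ker]
  constructor
  · intro h X Y
    have := congrArg (fun B : g →ₗ[ℝ] g →ₗ[ℝ] ℝ => B X Y) h
    simpa [extD] using this
  · intro h
    ext X Y
    simp [extD, h]

theorem ker_extD_eq_dualAnnihilator :
    LinearMap.ker (extD g) = (lowerCentralSeries ℝ g g 1).toSubmodule.dualAnnihilator := by
  ext σ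
  rw [mem_ker_extD_iff, Submodule.mem_dualAnnihilator]
  constructor
  · intro h
    have : (lowerCentralSeries ℝ g g (0 + 1)).toSubmodule ≤ LinearMap.ker σ :=
      (lowerCentralSeries_succ_le_iff 0 _).2 fun X Y _ => h X Y
    exact this
  · intro h X Y
    exact h _ (lie_mem_lowerCentralSeries_one X Y)

theorem finrank_lowerCentralSeries_one_add_firstBetti [FiniteDimensional ℝ g] :
    finrank ℝ (lowerCentralSeries ℝ g g 1).toSubmodule + firstBetti g = finrank ℝ g := by
  rw [firstBetti, ker_extD_eq_dualAnnihilator]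
  exact Subspace.finrank_add_finrank_dualAnnihilator_eq _

end LowerCentralSeries

/-! ### The nine algebras: nilpotency, Betti number and explicit complex structures. -/

section Listed

/-- The tuples `(de¹, …, de⁶)` of the listed algebras in terms of the values `w i j` of the
products of the coordinate forms. -/
def structureValues (w : Fin 6 → Fin 6 → ℝ) : Fin 9 → Fin 6 → ℝ :=
  ![![0, 0, 0, w 0 1, w 0 2, w 0 3],
    ![0, 0, 0, w 0 1, w 0 2, w 1 2],
    ![0, 0, 0, w 0 1, w 0 3, w 1 3],
    ![0, 0, 0, w 0 1, w 0 2, w 1 3],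
    ![0, 0, 0, w 0 1, w 0 2 + w 0 3, w 1 3],
    ![0, 0, 0, w 0 1, w 0 2, w 0 3 + w 1 2],
    ![0, 0, 0, w 0 1, w 0 3, w 0 2 + w 3 1],
    ![0, 0, 0, w 0 1, w 0 2 + w 3 1, w 0 3 + w 1 2],
    ![0, 0, 0, w 0 1, w 1 2, w 0 3 - w 2 4]]

theorem listed_lie_apply (n : Fin 9) (X Y : ListedAlgebra n) (k : Fin 6) :
    ⁅X, Y⁆ k = -structureValues (fun i j => X i * Y j - Y i * X j) n k := by
  rw [listed_bracket_apply]
  congr 1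
  fin_cases n <;> fin_cases k <;> rfl

/-- The `k`-th vector of the frame dual to the coframe of a listed algebra. -/
def frame (n : Fin 9) (k : Fin 6) : ListedAlgebra n := (Pi.single k 1 : Fin 6 → ℝ)

theorem frame_apply (n : Fin 9) (k l : Fin 6) : frame n k l = if l = k then 1 else 0 :=
  Pi.single_apply k (1 : ℝ) l

theorem listed_ext {n : Fin 9} {X Y : ListedAlgebra n} (h : ∀ k, X k = Y k) : X = Y := funext h

theorem listed_neg_apply (n : Fin 9) (X : ListedAlgebra n) (k : Fin 6) :
    (-X : ListedAlgebra n) k = -X k := rfl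

theorem listed_eq_sum (n : Fin 9) (X : ListedAlgebra n) :
    X = X 0 • frame n 0 + X 1 • frame n 1 + X 2 • frame n 2 + X 3 • frame n 3 +
      X 4 • frame n 4 + X 5 • frame n 5 := by
  apply listed_ext
  intro k
  fin_cases k <;> simp [listed_add_apply, listed_smul_apply, frame_apply]

instance (n : Fin 9) : FiniteDimensional ℝ (ListedAlgebra n) :=
  inferInstanceAs (FiniteDimensional ℝ (Fin 6 → ℝ))

theorem finrank_listed (n : Fin 9) : finrank ℝ (ListedAlgebra n) = 6 :=
  Module.finrank_fin_fun ℝ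

/-- The common kernel of the coordinates with indices in `s`. -/
def coordKer (n : Fin 9) (s : Set (Fin 6)) : Submodule ℝ (ListedAlgebra n) where
  carrier := {X | ∀ k ∈ s, X k = 0}
  add_mem' hX hY k hk := by rw [listed_add_apply, hX k hk, hY k hk, add_zero]
  zero_mem' k _ := listed_zero_apply n k
  smul_mem' c X hX k hk := by rw [listed_smul_apply, hX k hk, mul_zero]

theorem mem_coordKer {n : Fin 9} {s : Set (Fin 6)} {X : ListedAlgebra n} :
    X ∈ coordKer n s ↔ ∀ k ∈ s, X k = 0 := Iff.rfl

theorem lcs_one_listed_le (n : Fin 9) :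
    (lowerCentralSeries ℝ (ListedAlgebra n) (ListedAlgebra n) 1).toSubmodule ≤
      coordKer n {0, 1, 2} := by
  refine (lowerCentralSeries_succ_le_iff 0 _).2 fun X Y _ => ?_
  rw [mem_coordKer]
  fin_cases n <;> simp [listed_lie_apply, structureValues]

/-- The last algebra needs the sharper bound: its term e³⁵ keeps the fifth frame vector from being
central, so bounding only the first four coordinates would not make the next term vanish. -/
theorem lcs_two_listed_le (n : Fin 9) :
    (lowerCentralSeries ℝ (ListedAlgebra n) (ListedAlgebra n) 2).toSubmodule ≤
      coordKer n (if n = 8 then {0, 1, 2, 3, 4} else {0, 1, 2, 3}) := by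
  refine (lowerCentralSeries_succ_le_iff 1 _).2 fun X Y hY => ?_
  have h := mem_coordKer.1 (lcs_one_listed_le n hY)
  have h0 := h 0 (by simp)
  have h1 := h 1 (by simp)
  have h2 := h 2 (by simp)
  rw [mem_coordKer]
  fin_cases n <;> simp [listed_lie_apply, structureValues, h0, h1, h2]

theorem lcs_three_listed_eq_bot (n : Fin 9) :
    lowerCentralSeries ℝ (ListedAlgebra n) (ListedAlgebra n) 3 = ⊥ := by
  rw [← LieSubmodule.toSubmodule_eq_bot, eq_bot_iff]
  refine (lowerCentralSeries_succ_le_iff 2 _).2 fun X Y hY => ?_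
  have h := mem_coordKer.1 (lcs_two_listed_le n hY)
  rw [Submodule.mem_bot]
  apply listed_ext
  intro k
  rw [listed_zero_apply]
  fin_cases n <;> simp at h <;> fin_cases k <;>
    simp [listed_lie_apply, structureValues, h]

theorem isNilpotent_listed (n : Fin 9) : LieRing.IsNilpotent (ListedAlgebra n) :=
  (LieModule.isNilpotent_iff ℝ _ _).2 ⟨3, lcs_three_listed_eq_bot n⟩

/-- In every listed algebra the brackets of the frame pairs 12, 13, 14, 23, 24 already span the
derived algebra, so these five test pairs suffice. -/
theorem dual_lie_eq_zero_iff (n : Fin 9) (σ : Dual ℝ (ListedAlgebra n)) :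
    (∀ X Y : ListedAlgebra n, σ ⁅X, Y⁆ = 0) ↔
      σ (frame n 3) = 0 ∧ σ (frame n 4) = 0 ∧ σ (frame n 5) = 0 := by
  have expand : ∀ X : ListedAlgebra n, σ X = X 0 * σ (frame n 0) + X 1 * σ (frame n 1) +
      X 2 * σ (frame n 2) + X 3 * σ (frame n 3) + X 4 * σ (frame n 4) + X 5 * σ (frame n 5) := by
    intro X
    conv_lhs => rw [listed_eq_sum n X]
    simp only [map_add, map_smul, smul_eq_mul]
  constructor
  · intro h
    have h01 := h (frame n 0) (frame n 1)
    have h02 := h (frame n 0) (frame n 2)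
    have h03 := h (frame n 0) (frame n 3)
    have h12 := h (frame n 1) (frame n 2)
    have h13 := h (frame n 1) (frame n 3)
    rw [expand] at h01 h02 h03 h12 h13
    fin_cases n <;>
    simp [listed_lie_apply, structureValues,
      frame_apply] at h01 h02 h03 h12 h13 <;>
    refine ⟨?_, ?_, ?_⟩ <;> simp <;> linarith
  · rintro ⟨h3, h4, h5⟩ X Y
    have h := mem_coordKer.1 (lcs_one_listed_le n (lie_mem_lowerCentralSeries_one X Y))
    rw [expand, h3, h4, h5, h 0 (by simp), h 1 (by simp), h 2 (by simp)]
    ring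

theorem firstBetti_listed (n : Fin 9) : firstBetti (ListedAlgebra n) = 3 := by
  -- Spanning is checked dually: a form that annihilates the derived algebra annihilates the last
  -- three frame vectors.
  have h : coordKer n {0, 1, 2} ≤
      (lowerCentralSeries ℝ (ListedAlgebra n) (ListedAlgebra n) 1).toSubmodule := by
    rw [← Subspace.dualAnnihilator_le_dualAnnihilator_iff, ← ker_extD_eq_dualAnnihilator]
    intro σ hσ
    rw [mem_ker_extD_iff, dual_lie_eq_zero_iff] at hσ
    rw [Submodule.mem_dualAnnihilator]
    intro X hX
    rw [mem_coordKer] at hX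
    rw [listed_eq_sum n X, hX 0 (by simp), hX 1 (by simp), hX 2 (by simp)]
    simp [hσ]
  have h1 := (lcs_one_listed_le n).antisymm h
  have h2 := finrank_lowerCentralSeries_one_add_firstBetti (g := ListedAlgebra n)
  have h3 : finrank ℝ (coordKer n {0, 1, 2}) = 3 := by
    let e : coordKer n {0, 1, 2} ≃ₗ[ℝ] (Fin 3 → ℝ) :=
      { toFun := fun X => ![X.1 3, X.1 4, X.1 5]
        map_add' := fun X Y => by
          ext k
          fin_cases k <;> simp [listed_add_apply]
        map_smul' := fun c X => by
          ext k
          fin_cases k <;> simp [listed_smul_apply]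
        invFun := fun v => ⟨(![0, 0, 0, v 0, v 1, v 2] : Fin 6 → ℝ), by
          intro k hk
          simp only [Set.mem_insert_iff, Set.mem_singleton_iff] at hk
          rcases hk with rfl | rfl | rfl <;> rfl⟩
        left_inv := fun X => by
          have := mem_coordKer.1 X.2
          apply Subtype.ext
          apply listed_ext
          intro k
          fin_cases k <;> simp [this]
        right_inv := fun v => by
          ext k
          fin_cases k <;> simp }
    rw [e.finrank_eq, Module.finrank_fin_fun]
  rw [h1, h3, finrank_listed] at h2
  omega

/-- The endomorphism `J` of a listed algebra such that the forms `e¹ + (p₁ + i q₁) e²`,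
`e³ + (p₂ + i q₂) e⁴`, `e⁵ + (p₃ + i q₃) e⁶` have type `(1,0)`, where `qⱼ ≠ 0`. -/
def blockJ (n : Fin 9) (p q : Fin 3 → ℝ) : ListedAlgebra n →ₗ[ℝ] ListedAlgebra n :=
  show (Fin 6 → ℝ) →ₗ[ℝ] (Fin 6 → ℝ) from {
  toFun := fun X => ![-(q 0 * X 1) - p 0 * ((X 0 + p 0 * X 1) / q 0), (X 0 + p 0 * X 1) / q 0,
    -(q 1 * X 3) - p 1 * ((X 2 + p 1 * X 3) / q 1), (X 2 + p 1 * X 3) / q 1,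
    -(q 2 * X 5) - p 2 * ((X 4 + p 2 * X 5) / q 2), (X 4 + p 2 * X 5) / q 2]
  map_add' := fun X Y => by
    ext k
    fin_cases k <;> simp <;> ring
  map_smul' := fun c X => by
    ext k
    fin_cases k <;> simp <;> ring }

theorem blockJ_apply (n : Fin 9) (p q : Fin 3 → ℝ) (X : ListedAlgebra n) (k : Fin 6) :
    blockJ n p q X k =
      (![-(q 0 * X 1) - p 0 * ((X 0 + p 0 * X 1) / q 0), (X 0 + p 0 * X 1) / q 0,
        -(q 1 * X 3) - p 1 * ((X 2 + p 1 * X 3) / q 1), (X 2 + p 1 * X 3) / q 1,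
        -(q 2 * X 5) - p 2 * ((X 4 + p 2 * X 5) / q 2), (X 4 + p 2 * X 5) / q 2] : Fin 6 → ℝ) k :=
  rfl

theorem blockJ_sq (n : Fin 9) (p q : Fin 3 → ℝ) (hq : ∀ j, q j ≠ 0) (X : ListedAlgebra n) :
    blockJ n p q (blockJ n p q X) = -X := by
  have h0 := hq 0
  have h1 := hq 1
  have h2 := hq 2
  apply listed_ext
  intro k
  fin_cases k <;> simp [blockJ_apply, listed_neg_apply] <;> field_simp <;> ring

theorem complexDual_apply (n : Fin 9) (σ : ListedAlgebra n →ₗ[ℝ] ℂ) (X : ListedAlgebra n) :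
    σ X = X 0 * σ (frame n 0) + X 1 * σ (frame n 1) +
      X 2 * σ (frame n 2) + X 3 * σ (frame n 3) + X 4 * σ (frame n 4) + X 5 * σ (frame n 5) := by
  conv_lhs => rw [listed_eq_sum n X]
  simp only [map_add, map_smul, Complex.real_smul]

theorem formsOneZero_blockJ (n : Fin 9) (p q : Fin 3 → ℝ) (hq : ∀ j, q j ≠ 0) :
    formsOneZero (blockJ n p q) =
      spanL n (p 0 + q 0 * Complex.I) (p 1 + q 1 * Complex.I) (p 2 + q 2 * Complex.I) := by
  have hq' : ∀ j, (q j : ℂ) ≠ 0 := fun j => Complex.ofReal_ne_zero.2 (hq j)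
  have h0 := hq' 0
  have h1 := hq' 1
  have h2 := hq' 2
  apply le_antisymm
  · intro σ hσ
    have hσ' : ∀ X, σ (blockJ n p q X) = Complex.I * σ X := hσ
    -- On each coordinate plane, σ ∘ J = iσ evaluated at the first frame vector determines the value
    -- of σ at the second. So σ is fixed by three complex numbers, the coefficients of the three
    -- generators.
    have key : ∀ (r s : ℝ) (u v : ℂ), (s : ℂ) ≠ 0 →
        -(r * (1 / s) : ℂ) * u + 1 / s * v = Complex.I * u → v = (r + s * Complex.I) * u := by
      intro r s u v hs h
      field_simp at h
      linear_combination h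
    have a0 := hσ' (frame n 0)
    have a1 := hσ' (frame n 2)
    have a2 := hσ' (frame n 4)
    rw [complexDual_apply n σ (blockJ n p q _)] at a0 a1 a2
    simp [blockJ_apply, frame_apply] at a0 a1 a2
    have b0 := key (p 0) (q 0) (σ (frame n 0)) (σ (frame n 1)) h0 (by rw [← a0]; ring)
    have b1 := key (p 1) (q 1) (σ (frame n 2)) (σ (frame n 3)) h1 (by rw [← a1]; ring)
    have b2 := key (p 2) (q 2) (σ (frame n 4)) (σ (frame n 5)) h2 (by rw [← a2]; ring)
    refine Submodule.mem_span_triple.2 ⟨σ (frame n 0), σ (frame n 2), σ (frame n 4), ?_⟩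
    apply LinearMap.ext
    intro X
    rw [complexDual_apply n σ X, b0, b1, b2]
    simp only [LinearMap.add_apply, LinearMap.smul_apply, coframe, LinearMap.coe_mk,
      AddHom.coe_mk, smul_eq_mul]
    ring
  · refine Submodule.span_le.2 ?_
    rintro σ (rfl | rfl | rfl) X <;>
    simp only [LinearMap.add_apply, LinearMap.smul_apply, coframe, LinearMap.coe_mk,
      AddHom.coe_mk, smul_eq_mul, blockJ_apply] <;> simp <;> field_simp <;> ring_nf <;>
    simp <;> ring

/-- Real parts of the coefficients of the complex structures on the first eight algebras. -/
def blockRe : Fin 9 → Fin 3 → ℝ :=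
  ![![0, 0, 0], ![0, 0, 0], ![0, 0, 0], ![0, 1, 1], ![0, 0, 1], ![0, 0, 0], ![0, 0, 0],
    ![0, 0, 0], ![0, 0, 0]]

/-- Imaginary parts of the coefficients of the complex structures on the first eight algebras. -/
def blockIm : Fin 9 → Fin 3 → ℝ :=
  ![![1, 1, 1], ![1, 1, 1], ![1, 1, 1], ![1, 1, -1], ![1, 1, 1], ![2, 2, 1], ![-(1 / 2), 1, 1],
    ![1, 1, 1], ![1, 1, 1]]

theorem blockIm_ne_zero (n : Fin 9) (j : Fin 3) : blockIm n j ≠ 0 := by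
  fin_cases n <;> fin_cases j <;> simp [blockIm]

set_option maxHeartbeats 2000000 in
theorem isComplexStructure_blockJ (n : Fin 9) (hn : n ≠ 8) :
    IsComplexStructure (blockJ n (blockRe n) (blockIm n)) where
  sq := blockJ_sq n _ _ (blockIm_ne_zero n)
  integrable X Y := by
    apply listed_ext
    intro k
    fin_cases n
    rotate_right
    · exact absurd rfl hn
    all_goals
      fin_cases k <;>
      simp [listed_add_apply, listed_lie_apply, structureValues, blockJ_apply, blockRe,
        blockIm] <;> ring

/-- A complex structure on the last of the listed algebras. -/
def lastJ : ListedAlgebra 8 →ₗ[ℝ] ListedAlgebra 8 :=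
  show (Fin 6 → ℝ) →ₗ[ℝ] (Fin 6 → ℝ) from {
  toFun := fun X => ![-X 2, -X 5, X 0, X 4, -X 3, X 1]
  map_add' := fun X Y => by
    ext k
    fin_cases k <;> simp <;> ring
  map_smul' := fun c X => by
    ext k
    fin_cases k <;> simp }

theorem lastJ_apply (X : ListedAlgebra 8) (k : Fin 6) :
    lastJ X k = (![-X 2, -X 5, X 0, X 4, -X 3, X 1] : Fin 6 → ℝ) k := rfl

theorem isComplexStructure_lastJ : IsComplexStructure lastJ where
  sq X := by
    apply listed_ext
    intro k
    fin_cases k <;> simp [lastJ_apply, listed_neg_apply]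
  integrable X Y := by
    apply listed_ext
    intro k
    fin_cases k <;>
      simp [listed_add_apply, listed_lie_apply, structureValues, lastJ_apply] <;> ring

theorem formsOneZero_lastJ : formsOneZero lastJ = spanM 8 := by
  apply le_antisymm
  · intro σ hσ
    have hσ' : ∀ X, σ (lastJ X) = Complex.I * σ X := hσ
    have a0 := hσ' (frame 8 0)
    have a1 := hσ' (frame 8 3)
    have a2 := hσ' (frame 8 1)
    rw [complexDual_apply 8 σ (lastJ _)] at a0 a1 a2
    simp [lastJ_apply, frame_apply] at a0 a1 a2
    refine Submodule.mem_span_triple.2 ⟨σ (frame 8 0), σ (frame 8 3), σ (frame 8 1), ?_⟩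
    apply LinearMap.ext
    intro X
    rw [complexDual_apply 8 σ X, a0, a2]
    simp only [LinearMap.add_apply, LinearMap.sub_apply, LinearMap.smul_apply, coframe,
      LinearMap.coe_mk, AddHom.coe_mk, smul_eq_mul]
    linear_combination (X 4 : ℂ) * a1
  · refine Submodule.span_le.2 ?_
    rintro σ (rfl | rfl | rfl) X <;>
    simp only [LinearMap.add_apply, LinearMap.sub_apply, LinearMap.smul_apply, coframe,
      LinearMap.coe_mk, AddHom.coe_mk, smul_eq_mul, lastJ_apply] <;> simp <;> ring_nf <;>
    simp

theorem admitsComplexStructure_listed (n : Fin 9) : AdmitsComplexStructure (ListedAlgebra n) := by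
  by_cases hn : n = 8
  · subst hn
    exact ⟨lastJ, isComplexStructure_lastJ⟩
  · exact ⟨_, isComplexStructure_blockJ n hn⟩

end Listed

/-! ### Coframes and the classification of pencils of 2-forms. -/

section Coframe

variable {g : Type*} [LieRing g] [LieAlgebra ℝ g]

/-- The value of `f i ∧ f j` on `(X, Y)`. -/
def wedgeValue (f : Fin 6 → Dual ℝ g) (X Y : g) (i j : Fin 6) : ℝ := f i X * f j Y - f i Y * f j X

theorem wedgeValue_swap (f : Fin 6 → Dual ℝ g) (X Y : g) (i j : Fin 6) :
    wedgeValue f X Y j i = -wedgeValue f X Y i j := by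
  unfold wedgeValue
  ring

/-- A separating family of six 1-forms that satisfies the structure equations of a listed algebra
identifies `g` with that algebra. -/
theorem nonempty_equiv_of_coframe (hdim : finrank ℝ g = 6) (n : Fin 9) (f : Fin 6 → Dual ℝ g)
    (hsep : ∀ X, (∀ k, f k X = 0) → X = 0)
    (hlie : ∀ X Y k, f k ⁅X, Y⁆ = -structureValues (wedgeValue f X Y) n k) :
    Nonempty (g ≃ₗ⁅ℝ⁆ ListedAlgebra n) := by
  have : FiniteDimensional ℝ g := FiniteDimensional.of_finrank_pos (by omega)
  let F : g →ₗ[ℝ] ListedAlgebra n := show g →ₗ[ℝ] (Fin 6 → ℝ) from LinearMap.pi f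
  have hF : ∀ X k, F X k = f k X := fun X k => rfl
  let G : g →ₗ⁅ℝ⁆ ListedAlgebra n :=
    { F with
      map_lie' := by
        intro X Y
        apply listed_ext
        intro k
        rw [listed_lie_apply]
        exact hlie X Y k }
  have hinj : Function.Injective F := by
    rw [← LinearMap.ker_eq_bot, LinearMap.ker_eq_bot']
    intro X hX
    refine hsep X fun k => ?_
    rw [← hF, hX, listed_zero_apply]
  have hsurj : Function.Surjective F :=
    (LinearMap.injective_iff_surjective_of_finrank_eq_finrank
      (by rw [hdim, finrank_listed])).1 hinj
  exact ⟨LieEquiv.ofBijective G ⟨hinj, hsurj⟩⟩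

/-- The 2-form `M₀ e¹³ + M₁ e¹⁴ + M₂ e²³ + M₃ e²⁴` in terms of the values `w i j` of the products of
the coordinate forms. -/
def pencilForm (M : Fin 4 → ℝ) (w : Fin 6 → Fin 6 → ℝ) : ℝ :=
  M 0 * w 0 2 + M 1 * w 0 3 + M 2 * w 1 2 + M 3 * w 1 3

variable (g) in
/-- The dual of `g` has a basis that satisfies the structure equations
`(0, 0, 0, κ e¹², M, N)` with `κ ≠ 0`. -/
def HasPencil (M N : Fin 4 → ℝ) : Prop :=
  ∃ f : Fin 6 → Dual ℝ g, (∀ X, (∀ k, f k X = 0) → X = 0) ∧ ∃ κ : ℝ, κ ≠ 0 ∧ ∀ X Y,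
    f 0 ⁅X, Y⁆ = 0 ∧ f 1 ⁅X, Y⁆ = 0 ∧ f 2 ⁅X, Y⁆ = 0 ∧
    f 3 ⁅X, Y⁆ = -(κ * wedgeValue f X Y 0 1) ∧
    f 4 ⁅X, Y⁆ = -pencilForm M (wedgeValue f X Y) ∧ f 5 ⁅X, Y⁆ = -pencilForm N (wedgeValue f X Y)

variable {M N : Fin 4 → ℝ}

/-- The factor κ is absorbed by dividing e³, …, e⁶ by it: M and N are linear in e³, e⁴, so their
equations keep their form. Antisymmetry of `w` is assumed in order to match terms such as e⁴² with
−e²⁴. -/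
theorem HasPencil.nonempty_equiv (hdim : finrank ℝ g = 6) (h : HasPencil g M N) (n : Fin 9)
    (hn : ∀ w : Fin 6 → Fin 6 → ℝ, (∀ i j, w j i = -w i j) →
      structureValues w n = ![0, 0, 0, w 0 1, pencilForm M w, pencilForm N w]) :
    Nonempty (g ≃ₗ⁅ℝ⁆ ListedAlgebra n) := by
  obtain ⟨f, hsep, κ, hκ, hlie⟩ := h
  refine nonempty_equiv_of_coframe hdim n
    ![f 0, f 1, κ⁻¹ • f 2, κ⁻¹ • f 3, κ⁻¹ • f 4, κ⁻¹ • f 5] (fun X hX => hsep X fun k => ?_) ?_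
  · have := hX k
    fin_cases k <;> simpa [hκ] using this
  · intro X Y k
    obtain ⟨h0, h1, h2, h3, h4, h5⟩ := hlie X Y
    rw [hn _ (wedgeValue_swap _ X Y)]
    fin_cases k <;> simp [h0, h1, h2, h3, h4, h5, pencilForm, wedgeValue] <;> field_simp <;> ring

/-- Change of basis of the pencil spanned by `M` and `N`. -/
theorem HasPencil.combine (h : HasPencil g M N) (α β γ δ : ℝ) (hD : α * δ - β * γ ≠ 0) :
    HasPencil g (α • M + β • N) (γ • M + δ • N) := by
  obtain ⟨f, hsep, κ, hκ, hlie⟩ := h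
  refine ⟨![f 0, f 1, f 2, f 3, α • f 4 + β • f 5, γ • f 4 + δ • f 5],
    fun X hX => hsep X ?_, κ, hκ, ?_⟩
  · have h4 : α * f 4 X + β * f 5 X = 0 := hX 4
    have h5 : γ * f 4 X + δ * f 5 X = 0 := hX 5
    have h4' : f 4 X = 0 := by
      refine (mul_eq_zero.1 ?_).resolve_left hD
      linear_combination δ * h4 - β * h5
    have h5' : f 5 X = 0 := by
      refine (mul_eq_zero.1 ?_).resolve_left hD
      linear_combination α * h5 - γ * h4
    intro k
    have := hX k
    fin_cases k
    · exact this
    · exact this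
    · exact this
    · exact this
    · exact h4'
    · exact h5'
  · intro X Y
    obtain ⟨h0, h1, h2, h3, h4, h5⟩ := hlie X Y
    refine ⟨h0, h1, h2, h3, ?_, ?_⟩
    · simp [h4, h5, pencilForm, wedgeValue]
      ring
    · simp [h4, h5, pencilForm, wedgeValue]
      ring

/-- The effect on `pencilForm` of the substitution `e¹ ↦ p e¹ + q e²`, `e² ↦ r e¹ + s e²`,
`e³ ↦ t e³`, `e⁴ ↦ u e³ + v e⁴`. -/
def subst (p q r s t u v : ℝ) (M : Fin 4 → ℝ) : Fin 4 → ℝ :=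
  ![M 0 * t * p + M 1 * p * u + M 2 * t * r + M 3 * r * u, M 1 * p * v + M 3 * r * v,
    M 0 * t * q + M 1 * q * u + M 2 * t * s + M 3 * s * u, M 1 * q * v + M 3 * s * v]

/-- The old coframe is expressed through the new one. Since e³ is closed, adding a multiple of it to
e⁴ does not affect de⁴; only κ is rescaled, by v⁻¹(ps − qr). -/
theorem HasPencil.subst (h : HasPencil g M N) (p q r s t u v : ℝ) (hD : p * s - q * r ≠ 0)
    (ht : t ≠ 0) (hv : v ≠ 0) :
    HasPencil g (subst p q r s t u v M) (subst p q r s t u v N) := by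
  obtain ⟨f, hsep, κ, hκ, hlie⟩ := h
  obtain ⟨f0, hf0⟩ : ∃ f0, f0 = (p * s - q * r)⁻¹ • (s • f 0 - q • f 1) := ⟨_, rfl⟩
  obtain ⟨f1, hf1⟩ : ∃ f1, f1 = (p * s - q * r)⁻¹ • (p • f 1 - r • f 0) := ⟨_, rfl⟩
  obtain ⟨f2, hf2⟩ : ∃ f2, f2 = t⁻¹ • f 2 := ⟨_, rfl⟩
  obtain ⟨f3, hf3⟩ : ∃ f3, f3 = v⁻¹ • (f 3 - u • f2) := ⟨_, rfl⟩
  have e0 : ∀ X, f 0 X = p * f0 X + q * f1 X := by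
    intro X
    simp [hf0, hf1]
    field_simp
    ring
  have e1 : ∀ X, f 1 X = r * f0 X + s * f1 X := by
    intro X
    simp [hf0, hf1]
    linear_combination -(f 1 X) * inv_mul_cancel₀ hD
  have e2 : ∀ X, f 2 X = t * f2 X := by
    intro X
    simp [hf2]
    field_simp
  have e3 : ∀ X, f 3 X = u * f2 X + v * f3 X := by
    intro X
    simp [hf3]
    field_simp
    ring
  refine ⟨![f0, f1, f2, f3, f 4, f 5], fun X hX => hsep X ?_, v⁻¹ * κ * (p * s - q * r),
    by positivity, ?_⟩
  · have h0 : f0 X = 0 := hX 0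
    have h1 : f1 X = 0 := hX 1
    have h2 : f2 X = 0 := hX 2
    have h3 : f3 X = 0 := hX 3
    intro k
    have := hX k
    fin_cases k
    · simp [e0, h0, h1]
    · simp [e1, h0, h1]
    · simp [e2, h2]
    · simp [e3, h2, h3]
    · exact this
    · exact this
  · intro X Y
    obtain ⟨h0, h1, h2, h3, h4, h5⟩ := hlie X Y
    refine ⟨?_, ?_, ?_, ?_, ?_, ?_⟩
    · simp [hf0, h0, h1]
    · simp [hf1, h0, h1]
    · simp [hf2, h2]
    · simp only [wedgeValue, e0, e1] at h3
      simp [hf3, hf2, h2, h3, wedgeValue]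
      field_simp
      ring
    · simp only [wedgeValue, pencilForm, e0, e1, e2, e3] at h4
      simp [h4, wedgeValue, pencilForm, NilpotentComplex.subst]
      ring
    · simp only [wedgeValue, pencilForm, e0, e1, e2, e3] at h5
      simp [h5, wedgeValue, pencilForm, NilpotentComplex.subst]
      ring

theorem HasPencil.congr {M' N' : Fin 4 → ℝ} (h : HasPencil g M N) (hM : M = M') (hN : N = N') :
    HasPencil g M' N' := hM ▸ hN ▸ h

/-- For d ≠ 0, completing the product b e¹⁴ + c e²³ + d e²⁴ = d (e² + (b/d) e¹) ∧ (e⁴ + (c/d) e³) −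
(bc/d) e¹³ gives algebra 4. For d = 0, the vanishing of b and c distinguishes algebras 1, 2 and 6.
-/
theorem HasPencil.nonempty_equiv_of_e13 (hdim : finrank ℝ g = 6) {b c d : ℝ}
    (h : HasPencil g ![1, 0, 0, 0] ![0, b, c, d]) (hne : b ≠ 0 ∨ c ≠ 0 ∨ d ≠ 0) :
    ∃ n, Nonempty (g ≃ₗ⁅ℝ⁆ ListedAlgebra n) := by
  by_cases hd : d = 0
  · subst hd
    by_cases hc : c = 0
    · subst hc
      have hb : b ≠ 0 := by simpa using hne
      refine ⟨0, ((h.combine 1 0 0 b⁻¹ (by simpa using hb)).congr (M' := ![1, 0, 0, 0])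
        (N' := ![0, 1, 0, 0]) ?_ ?_).nonempty_equiv hdim 0 ?_⟩
      · ext k; fin_cases k <;> simp
      · ext k; fin_cases k <;> simp [hb]
      · intro w _; ext k; fin_cases k <;> simp [structureValues, pencilForm]
    · by_cases hb : b = 0
      · subst hb
        refine ⟨1, ((h.combine 1 0 0 c⁻¹ (by simpa using hc)).congr (M' := ![1, 0, 0, 0])
          (N' := ![0, 0, 1, 0]) ?_ ?_).nonempty_equiv hdim 1 ?_⟩
        · ext k; fin_cases k <;> simp
        · ext k; fin_cases k <;> simp [hc]
        · intro w _; ext k; fin_cases k <;> simp [structureValues, pencilForm]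
      · refine ⟨5, ((h.subst 1 0 0 c⁻¹ 1 0 b⁻¹ (by simpa using hc) one_ne_zero
          (by simpa using hb)).congr (M' := ![1, 0, 0, 0])
          (N' := ![0, 1, 1, 0]) ?_ ?_).nonempty_equiv hdim 5 ?_⟩
        · ext k; fin_cases k <;> simp [NilpotentComplex.subst]
        · ext k; fin_cases k <;> simp [NilpotentComplex.subst, hb, hc]
        · intro w _; ext k; fin_cases k <;> simp [structureValues, pencilForm]
  · refine ⟨3, (((h.subst 1 0 (-(b / d)) 1 1 (-(c / d)) d⁻¹ (by simp) one_ne_zero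
      (by simpa using hd)).combine 1 0 (b * c / d) 1 (by simp)).congr (M' := ![1, 0, 0, 0])
      (N' := ![0, 0, 0, 1]) ?_ ?_).nonempty_equiv hdim 3 ?_⟩
    · ext k; fin_cases k <;> simp [NilpotentComplex.subst]
    · ext k; fin_cases k <;> simp [NilpotentComplex.subst] <;> field_simp <;> ring
    · intro w _; ext k; fin_cases k <;> simp [structureValues, pencilForm]

/-- For c = 0, the vanishing of a and d distinguishes algebras 3, 1 and 7. For c ≠ 0, taking a e¹ +
c e² as new e² turns the pencil into ⟨e¹⁴, e²³ + (d/c) e²⁴⟩; after exchanging e¹ and e² this is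
algebra 4 or 5, according to whether d vanishes. -/
theorem HasPencil.nonempty_equiv_of_e14 (hdim : finrank ℝ g = 6) {a c d : ℝ}
    (h : HasPencil g ![0, 1, 0, 0] ![a, 0, c, d]) (hne : a ≠ 0 ∨ c ≠ 0 ∨ d ≠ 0) :
    ∃ n, Nonempty (g ≃ₗ⁅ℝ⁆ ListedAlgebra n) := by
  by_cases hc : c = 0
  · subst hc
    by_cases ha : a = 0
    · subst ha
      have hd : d ≠ 0 := by simpa using hne
      refine ⟨2, ((h.combine 1 0 0 d⁻¹ (by simpa using hd)).congr (M' := ![0, 1, 0, 0])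
        (N' := ![0, 0, 0, 1]) ?_ ?_).nonempty_equiv hdim 2 ?_⟩
      · ext k; fin_cases k <;> simp
      · ext k; fin_cases k <;> simp [hd]
      · intro w _; ext k; fin_cases k <;> simp [structureValues, pencilForm]
    · by_cases hd : d = 0
      · subst hd
        refine ⟨0, ((h.combine 0 a⁻¹ 1 0 (by simpa using ha)).congr (M' := ![1, 0, 0, 0])
          (N' := ![0, 1, 0, 0]) ?_ ?_).nonempty_equiv hdim 0 ?_⟩
        · ext k; fin_cases k <;> simp [ha]
        · ext k; fin_cases k <;> simp
        · intro w _; ext k; fin_cases k <;> simp [structureValues, pencilForm]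
      · refine ⟨6, ((h.subst 1 0 0 (-d⁻¹) a⁻¹ 0 1 (by simpa using hd) (by simpa using ha)
          one_ne_zero).congr (M' := ![0, 1, 0, 0])
          (N' := ![1, 0, 0, -1]) ?_ ?_).nonempty_equiv hdim 6 ?_⟩
        · ext k; fin_cases k <;> simp [NilpotentComplex.subst]
        · ext k; fin_cases k <;> simp [NilpotentComplex.subst, ha, hd]
        · intro w hw; ext k; fin_cases k <;> simp [structureValues, pencilForm, hw 1 3]
  · have h' := ((h.subst 1 0 (-(a / c)) c⁻¹ 1 0 1 (by simpa using hc) one_ne_zero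
      one_ne_zero).combine 1 0 (a * d / c) 1 (by simp)).subst 0 1 1 0 1 0 1 (by simp) one_ne_zero
      one_ne_zero
    by_cases hd : d = 0
    · subst hd
      refine ⟨3, ((h'.combine 0 1 1 0 (by simp)).congr (M' := ![1, 0, 0, 0])
        (N' := ![0, 0, 0, 1]) ?_ ?_).nonempty_equiv hdim 3 ?_⟩
      · ext k; fin_cases k <;> simp [NilpotentComplex.subst] <;> field_simp <;> ring
      · ext k; fin_cases k <;> simp [NilpotentComplex.subst]
      · intro w _; ext k; fin_cases k <;> simp [structureValues, pencilForm]
    · refine ⟨4, (((h'.combine 0 1 (d / c) 0 (by simp [hc, hd])).subst 1 0 0 1 1 0 (c / d) (by simp)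
        one_ne_zero (by simp [hc, hd])).congr (M' := ![1, 1, 0, 0])
        (N' := ![0, 0, 0, 1]) ?_ ?_).nonempty_equiv hdim 4 ?_⟩
      · ext k; fin_cases k <;> simp [NilpotentComplex.subst, hc, hd] <;> field_simp <;> ring
      · ext k; fin_cases k <;> simp [NilpotentComplex.subst] <;> field_simp
      · intro w _; ext k; fin_cases k <;> simp [structureValues, pencilForm]

/-- The case of a pencil that contains a form of the shape `e¹ ∧ (x e³ + y e⁴)`. -/
theorem HasPencil.nonempty_equiv_of_e1 (hdim : finrank ℝ g = 6) {x y : ℝ}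
    (h : HasPencil g ![x, y, 0, 0] N) (hxy : x ≠ 0 ∨ y ≠ 0)
    (hN : ∀ r : ℝ, N ≠ r • ![x, y, 0, 0]) : ∃ n, Nonempty (g ≃ₗ⁅ℝ⁆ ListedAlgebra n) := by
  by_cases hy : y = 0
  · subst hy
    have hx : x ≠ 0 := by simpa using hxy
    refine HasPencil.nonempty_equiv_of_e13 hdim (b := N 1) (c := N 2) (d := N 3)
      ((h.combine x⁻¹ 0 (-(N 0) / x) 1 (by simpa using hx)).congr ?_ ?_) ?_
    · ext k; fin_cases k <;> simp [hx]
    · ext k; fin_cases k <;> simp [hx]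
    · by_contra! hc
      apply hN (N 0 / x)
      ext k; fin_cases k <;> simp [hx, hc]
  · refine HasPencil.nonempty_equiv_of_e14 hdim (a := N 0 - N 1 * x / y) (c := N 2 - N 3 * x / y)
      (d := N 3 / y)
      -- The new e⁴ is x e³ + y e⁴, which makes the first form e¹⁴; a multiple of it then clears the
      -- e¹⁴ term of the second.
      (((h.subst 1 0 0 1 1 (-(x / y)) y⁻¹ (by simp) one_ne_zero
        (by simpa using hy)).combine 1 0 (-(N 1) / y) 1 (by simp)).congr ?_ ?_) ?_
    · ext k; fin_cases k <;> simp [NilpotentComplex.subst] <;> field_simp <;> ring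
    · ext k; fin_cases k <;> simp [NilpotentComplex.subst] <;> field_simp <;> ring
    · by_contra! hc
      obtain ⟨h0, h2, h3⟩ := hc
      have h3' : N 3 = 0 := by simpa [hy] using h3
      rw [h3'] at h2
      have h2' : N 2 = 0 := by simpa using h2
      apply hN (N 1 / y)
      ext k; fin_cases k
      · simp; field_simp; field_simp at h0; linarith
      · simp [hy]
      · simp [h2']
      · simp [h3']

/-- The case of a pencil that contains a decomposable form. -/
theorem HasPencil.nonempty_equiv_of_decomposable (hdim : finrank ℝ g = 6) {p q x y : ℝ}
    (h : HasPencil g ![p * x, p * y, q * x, q * y] N) (hpq : p ≠ 0 ∨ q ≠ 0) (hxy : x ≠ 0 ∨ y ≠ 0)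
    (hN : ∀ r : ℝ, N ≠ r • ![p * x, p * y, q * x, q * y]) :
    ∃ n, Nonempty (g ≃ₗ⁅ℝ⁆ ListedAlgebra n) := by
  by_cases hp : p = 0
  · subst hp
    have hq : q ≠ 0 := by simpa using hpq
    -- The form is (p e¹ + q e²) ∧ (x e³ + y e⁴); here and for p ≠ 0 the substitution makes its
    -- first factor the new e¹.
    refine ((h.subst 0 1 q⁻¹ 0 1 0 1 (by simpa using hq) one_ne_zero one_ne_zero).congr
      (M' := ![x, y, 0, 0]) ?_ rfl).nonempty_equiv_of_e1 hdim hxy fun r hr => hN r ?_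
    · ext k; fin_cases k <;> simp [NilpotentComplex.subst] <;> field_simp
    · have h0 := congrFun hr 0
      have h1 := congrFun hr 1
      have h2 := congrFun hr 2
      have h3 := congrFun hr 3
      simp [NilpotentComplex.subst] at h0 h1 h2 h3
      field_simp at h0 h1
      ext k; fin_cases k <;> simp <;> linarith
  · refine ((h.subst p⁻¹ (-(q / p)) 0 1 1 0 1 (by simpa using hp) one_ne_zero one_ne_zero).congr
      (M' := ![x, y, 0, 0]) ?_ rfl).nonempty_equiv_of_e1 hdim hxy fun r hr => hN r ?_
    · ext k; fin_cases k <;> simp [NilpotentComplex.subst] <;> field_simp <;> ring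
    · have h0 := congrFun hr 0
      have h1 := congrFun hr 1
      have h2 := congrFun hr 2
      have h3 := congrFun hr 3
      simp [NilpotentComplex.subst] at h0 h1 h2 h3
      field_simp at h0 h1 h2 h3
      have k0 : N 0 = r * (p * x) := by linarith
      have k1 : N 1 = r * (p * y) := by linarith
      rw [k0] at h2
      rw [k1] at h3
      ext k; fin_cases k
      · simp [k0]
      · simp [k1]
      · simp
        apply mul_left_cancel₀ hp
        linarith
      · simp
        apply mul_left_cancel₀ hp
        linarith

/-- The case of a pencil without decomposable forms. -/
theorem HasPencil.nonempty_equiv_of_definite (hdim : finrank ℝ g = 6) {c d c' d' : ℝ}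
    (h : HasPencil g ![1, 0, c, d] ![0, 1, c', d']) (hneg : (c - d') ^ 2 + 4 * d * c' < 0) :
    Nonempty (g ≃ₗ⁅ℝ⁆ ListedAlgebra 7) := by
  have hd : d ≠ 0 := by
    rintro rfl
    nlinarith [sq_nonneg (c - d')]
  obtain ⟨σ, hσ⟩ : ∃ σ, σ = (c - d') / 2 := ⟨_, rfl⟩
  obtain ⟨κ, hκ⟩ : ∃ κ, κ = Real.sqrt (-(σ ^ 2 + d * c')) := ⟨_, rfl⟩
  have hpos : 0 < -(σ ^ 2 + d * c') := by
    rw [hσ]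
    nlinarith
  have hκ0 : 0 < κ := hκ ▸ Real.sqrt_pos.2 hpos
  have hκ2 : κ ^ 2 = -(σ ^ 2 + d * c') := hκ ▸ Real.sq_sqrt hpos.le
  -- Adding a multiple of e² to e¹ shifts the matrix with rows (c, d), (c', d') by a scalar matrix,
  -- here making it trace-free. The next change clears its diagonal, and κ finally scales the
  -- off-diagonal entries to ∓1.
  have h1 : HasPencil g ![1, 0, σ, d] ![0, 1, c', -σ] := by
    refine (h.subst 1 (-((c + d') / 2)) 0 1 1 0 1 (by simp) one_ne_zero one_ne_zero).congr ?_ ?_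
    · ext k; fin_cases k <;> simp [NilpotentComplex.subst, hσ] <;> ring
    · ext k; fin_cases k <;> simp [NilpotentComplex.subst, hσ] <;> ring
  have h2 : HasPencil g ![1, 0, 0, 1] ![0, 1, -κ ^ 2, 0] := by
    refine ((h1.subst 1 0 0 1 1 (-(σ / d)) d⁻¹ (by simp) one_ne_zero (by simpa using hd)).combine
      1 0 σ d (by simpa using hd)).congr ?_ ?_
    · ext k; fin_cases k <;> simp [NilpotentComplex.subst] <;> field_simp <;> ring
    · ext k; fin_cases k <;> simp [NilpotentComplex.subst, hκ2] <;> field_simp <;> ring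
  refine (((h2.subst 1 0 0 (-κ⁻¹) 1 0 κ (by simp [hκ0.ne']) one_ne_zero hκ0.ne').combine
      1 0 0 κ⁻¹ (by simp [hκ0.ne'])).congr (M' := ![1, 0, 0, -1])
      (N' := ![0, 1, 1, 0]) ?_ ?_).nonempty_equiv hdim 7 ?_
  · ext k; fin_cases k <;> simp [NilpotentComplex.subst, hκ0.ne']
  · ext k; fin_cases k <;> simp [NilpotentComplex.subst] <;> field_simp
  · intro w hw; ext k; fin_cases k <;> simp [structureValues, pencilForm, hw 1 3]

/-- The question is whether some combination of M and N has rank one. If the e¹-parts of M and N are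
dependent, a combination is divisible by e². Otherwise the pencil is normalised to e¹³ + c e²³ + d
e²⁴ and e¹⁴ + c' e²³ + d' e²⁴, and rank-one elements correspond to real row eigenvectors of the
matrix with rows (c, d), (c', d'). -/
theorem HasPencil.exists_nonempty_equiv (hdim : finrank ℝ g = 6) (h : HasPencil g M N)
    (hMN : ∀ s t : ℝ, s • M + t • N = 0 → s = 0 ∧ t = 0) :
    ∃ n, Nonempty (g ≃ₗ⁅ℝ⁆ ListedAlgebra n) := by
  have key : ∀ s t p q x y : ℝ, (s ≠ 0 ∨ t ≠ 0) →
      s • M + t • N = ![p * x, p * y, q * x, q * y] →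
      ∃ n, Nonempty (g ≃ₗ⁅ℝ⁆ ListedAlgebra n) := by
    intro s t p q x y hst heq
    have hne : ![p * x, p * y, q * x, q * y] ≠ 0 := by
      intro h0
      rw [h0] at heq
      have := hMN s t heq
      tauto
    have hpq : p ≠ 0 ∨ q ≠ 0 := by
      by_contra! hc
      apply hne
      ext k; fin_cases k <;> simp [hc]
    have hxy : x ≠ 0 ∨ y ≠ 0 := by
      by_contra! hc
      apply hne
      ext k; fin_cases k <;> simp [hc]
    -- The pair (s, t) is completed to a basis change of the pencil by (−t, s), whose determinant is
    -- s² + t².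
    have hpos : s * s - t * -t ≠ 0 := by
      rcases hst with hs | ht
      · have := mul_self_pos.2 hs
        nlinarith [mul_self_nonneg t]
      · have := mul_self_pos.2 ht
        nlinarith [mul_self_nonneg s]
    refine ((h.combine s t (-t) s hpos).congr heq rfl).nonempty_equiv_of_decomposable hdim hpq hxy
      fun r hr => hpos ?_
    rw [← heq] at hr
    have := hMN (-t - r * s) (s - r * t) (by
      have h0 := sub_eq_zero.2 hr
      rw [← h0]
      module)
    linear_combination -t * this.1 + s * this.2
  by_cases hΔ : M 0 * N 1 - M 1 * N 0 = 0
  · by_cases h0 : M 0 = 0 ∧ M 1 = 0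
    · refine key 1 0 0 1 (M 2) (M 3) (by simp) ?_
      ext k; fin_cases k <;> simp [h0]
    · by_cases hM0 : M 0 = 0
      · have hM1 : M 1 ≠ 0 := fun h1 => h0 ⟨hM0, h1⟩
        refine key (N 1) (-M 1) 0 1 (N 1 * M 2 - M 1 * N 2) (N 1 * M 3 - M 1 * N 3)
          (by simp [hM1]) ?_
        ext k; fin_cases k <;> simp <;> linarith
      · refine key (N 0) (-M 0) 0 1 (N 0 * M 2 - M 0 * N 2) (N 0 * M 3 - M 0 * N 3)
          (by simp [hM0]) ?_
        ext k; fin_cases k <;> simp <;> linarith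
  · obtain ⟨D, hD⟩ : ∃ D, D = M 0 * N 1 - M 1 * N 0 := ⟨_, rfl⟩
    rw [← hD] at hΔ
    obtain ⟨c, hc⟩ : ∃ c, c = (N 1 * M 2 - M 1 * N 2) / D := ⟨_, rfl⟩
    obtain ⟨d, hd⟩ : ∃ d, d = (N 1 * M 3 - M 1 * N 3) / D := ⟨_, rfl⟩
    obtain ⟨c', hc'⟩ : ∃ c', c' = (M 0 * N 2 - N 0 * M 2) / D := ⟨_, rfl⟩
    obtain ⟨d', hd'⟩ : ∃ d', d' = (M 0 * N 3 - N 0 * M 3) / D := ⟨_, rfl⟩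
    have hA : (N 1 / D) • M + (-M 1 / D) • N = ![1, 0, c, d] := by
      ext k; fin_cases k <;> simp [hc, hd] <;> field_simp <;> linarith
    have hB : (-N 0 / D) • M + (M 0 / D) • N = ![0, 1, c', d'] := by
      ext k; fin_cases k <;> simp [hc', hd'] <;> field_simp <;> linarith
    have hdet : N 1 / D * (M 0 / D) - -M 1 / D * (-N 0 / D) ≠ 0 := by
      have : N 1 / D * (M 0 / D) - -M 1 / D * (-N 0 / D) = 1 / D := by
        field_simp
        linarith
      rw [this]
      positivity
    by_cases hneg : (c - d') ^ 2 + 4 * d * c' < 0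
    · exact ⟨7, ((h.combine _ _ _ _ hdet).congr hA hB).nonempty_equiv_of_definite hdim hneg⟩
    · have hrt := Real.mul_self_sqrt (not_lt.1 hneg)
      obtain ⟨l, hl⟩ : ∃ l, l = (c + d' + Real.sqrt ((c - d') ^ 2 + 4 * d * c')) / 2 := ⟨_, rfl⟩
      have hchar : (c - l) * (d' - l) - d * c' = 0 := by
        rw [hl]
        linear_combination hrt / 4
      -- A row eigenvector (x, y) with eigenvalue l yields the decomposable form (e¹ + l e²) ∧ (x e³
      -- + y e⁴).
      have comb : ∀ x y : ℝ, x * c + y * c' = l * x → x * d + y * d' = l * y →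
          (x * (N 1 / D) + y * (-N 0 / D)) • M + (x * (-M 1 / D) + y * (M 0 / D)) • N =
            ![1 * x, 1 * y, l * x, l * y] := by
        intro x y h1 h2
        have : (x * (N 1 / D) + y * (-N 0 / D)) • M + (x * (-M 1 / D) + y * (M 0 / D)) • N =
            x • ![1, 0, c, d] + y • ![0, 1, c', d'] := by
          rw [← hA, ← hB]
          module
        rw [this]
        ext k; fin_cases k <;> simp <;> linarith
      have nz : ∀ x y : ℝ, (x ≠ 0 ∨ y ≠ 0) →
          (x * (N 1 / D) + y * (-N 0 / D) ≠ 0 ∨ x * (-M 1 / D) + y * (M 0 / D) ≠ 0) := by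
        intro x y hxy
        by_contra! hcon
        have hx : x * D = 0 := by
          have := congrArg (D * ·) hcon.1
          have h2 := congrArg (D * ·) hcon.2
          field_simp at this h2
          rw [hD]
          linear_combination M 0 * this + N 0 * h2
        have hy : y * D = 0 := by
          have := congrArg (D * ·) hcon.1
          have h2 := congrArg (D * ·) hcon.2
          field_simp at this h2
          rw [hD]
          linear_combination M 1 * this + N 1 * h2
        simp [hΔ] at hx hy
        tauto
      -- Eigenvectors are read off from the singular matrix: (c', l − c) or (d' − l, −d), whichever
      -- is nonzero. If both vanish, the matrix is scalar and (1, 0) serves.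
      by_cases h1 : c' = 0 ∧ c = l
      · by_cases h2 : d = 0 ∧ d' = l
        · exact key _ _ _ _ _ _ (nz 1 0 (by simp)) (comb 1 0 (by linarith) (by linarith))
        · refine key _ _ _ _ _ _ (nz (d' - l) (-d) ?_) (comb (d' - l) (-d) ?_ ?_)
          · by_contra! hcon
            exact h2 ⟨by linarith, by linarith⟩
          · linear_combination hchar
          · ring
      · refine key _ _ _ _ _ _ (nz c' (l - c) ?_) (comb c' (l - c) ?_ ?_)
        · by_contra! hcon
          exact h1 ⟨by linarith, by linarith⟩
        · ring
        · linear_combination -hchar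

end Coframe

/-! ### Consequences of nilpotency. -/

section LowerCentral

variable {g : Type*} [LieRing g] [LieAlgebra ℝ g]

variable (g) in
/-- The terms of the lower central series as subspaces. -/
abbrev lcSub (k : ℕ) : Submodule ℝ g := (lowerCentralSeries ℝ g g k).toSubmodule

theorem lie_mem_lcSub_succ {k : ℕ} (X : g) {Y : g} (hY : Y ∈ lcSub g k) :
    ⁅X, Y⁆ ∈ lcSub g (k + 1) :=
  lie_mem_lowerCentralSeries_succ X hY

theorem lie_mem_lcSub_succ' {k : ℕ} {X : g} (Y : g) (hX : X ∈ lcSub g k) :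
    ⁅X, Y⁆ ∈ lcSub g (k + 1) := by
  rw [← lie_skew]
  exact Submodule.neg_mem _ (lie_mem_lcSub_succ Y hX)

theorem lcSub_succ_le (k : ℕ) : lcSub g (k + 1) ≤ lcSub g k :=
  antitone_lowerCentralSeries ℝ g g (Nat.le_succ k)

theorem lcSub_succ_mono {k l : ℕ} (h : lcSub g k ≤ lcSub g l) : lcSub g (k + 1) ≤ lcSub g (l + 1) :=
  (lowerCentralSeries_succ_le_iff k _).2 fun X _ hY => lie_mem_lcSub_succ X (h hY)

theorem exists_lcSub_eq_bot (hnil : LieRing.IsNilpotent g) : ∃ k, lcSub g k = ⊥ := by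
  obtain ⟨k, hk⟩ := (LieModule.isNilpotent_iff ℝ g g).1 hnil
  exact ⟨k, by rw [lcSub, hk]; rfl⟩

theorem lcSub_eq_bot_of_le_succ (hnil : LieRing.IsNilpotent g) {k : ℕ}
    (h : lcSub g k ≤ lcSub g (k + 1)) : lcSub g k = ⊥ := by
  have key : ∀ j, lcSub g k ≤ lcSub g (k + j) := by
    intro j
    induction j with
    | zero => exact le_rfl
    | succ j ih => exact h.trans (lcSub_succ_mono ih)
  obtain ⟨m, hm⟩ := exists_lcSub_eq_bot hnil
  have h1 : lcSub g (k + m) ≤ lcSub g m := antitone_lowerCentralSeries ℝ g g (Nat.le_add_left m k)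
  exact eq_bot_iff.2 (((key m).trans h1).trans hm.le)

theorem finrank_lcSub_succ_lt [FiniteDimensional ℝ g] (hnil : LieRing.IsNilpotent g) {k : ℕ}
    (h : lcSub g k ≠ ⊥) : finrank ℝ (lcSub g (k + 1)) < finrank ℝ (lcSub g k) :=
  Submodule.finrank_lt_finrank_of_lt (lt_of_le_not_ge (lcSub_succ_le k) fun hle =>
    h (lcSub_eq_bot_of_le_succ hnil hle))

/-- An eigenvector of ad T with nonzero eigenvalue would lie in every term of the lower central
series. -/
theorem eq_zero_of_lie_eq_smul (hnil : LieRing.IsNilpotent g) {T v : g} {c : ℝ} (hc : c ≠ 0)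
    (h : ⁅T, v⁆ = c • v) : v = 0 := by
  have key : ∀ k, v ∈ lcSub g k := by
    intro k
    induction k with
    | zero => simp
    | succ k ih =>
      have := Submodule.smul_mem _ c⁻¹ (lie_mem_lcSub_succ T ih)
      rwa [h, smul_smul, inv_mul_cancel₀ hc, one_smul] at this
  obtain ⟨k, hk⟩ := exists_lcSub_eq_bot hnil
  have := key k
  rwa [hk, Submodule.mem_bot] at this

/-- The last nonzero term of the series is central and is contained in the given one. -/
theorem exists_central_mem_lcSub (hnil : LieRing.IsNilpotent g) {k : ℕ} (h : lcSub g k ≠ ⊥) :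
    ∃ z ∈ lcSub g k, z ≠ 0 ∧ ∀ T : g, ⁅T, z⁆ = 0 := by
  obtain ⟨m, hm⟩ := exists_lcSub_eq_bot hnil
  have : ∃ j, lcSub g (k + j) = ⊥ := by
    have hle : lcSub g (k + m) ≤ lcSub g m :=
      antitone_lowerCentralSeries ℝ g g (Nat.le_add_left m k)
    exact ⟨m, eq_bot_iff.2 (hle.trans hm.le)⟩
  classical
  obtain ⟨j, hj⟩ : ∃ j, Nat.find this = j + 1 :=
    Nat.exists_eq_succ_of_ne_zero fun h0 => by
      have h3 := Nat.find_spec this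
      rw [h0] at h3
      exact h h3
  have h1 : lcSub g (k + j) ≠ ⊥ := Nat.find_min this (by omega)
  have h2 : lcSub g (k + j + 1) = ⊥ := by
    have := Nat.find_spec this
    rwa [hj] at this
  obtain ⟨z, hz, hz0⟩ := Submodule.exists_mem_ne_zero_of_ne_bot h1
  refine ⟨z, antitone_lowerCentralSeries ℝ g g (Nat.le_add_right k j) hz, hz0, fun T => ?_⟩
  have := lie_mem_lcSub_succ T hz
  rwa [h2, Submodule.mem_bot] at this

end LowerCentral

/-! ### Linear algebra of J-invariant subspaces. -/

section ComplexSubspaces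

variable {V : Type*} [AddCommGroup V] [Module ℝ V] {J : V →ₗ[ℝ] V}

/-- Apply x − yJ, which preserves S: since (x − yJ)(x + yJ) = x² + y², a nonzero pair would put v
into S. Thus v and Jv are independent modulo S. -/
theorem smul_add_smul_mem (hJ : ∀ X, J (J X) = -X) {S : Submodule ℝ V} (hS : ∀ X ∈ S, J X ∈ S)
    {v : V} (hv : v ∉ S) {x y : ℝ} (h : x • v + y • J v ∈ S) : x = 0 ∧ y = 0 := by
  have h1 : (x ^ 2 + y ^ 2) • v ∈ S := by
    have h2 := Submodule.sub_mem _ (Submodule.smul_mem _ x h) (Submodule.smul_mem _ y (hS _ h))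
    have h3 : x • (x • v + y • J v) - y • J (x • v + y • J v) = (x ^ 2 + y ^ 2) • v := by
      rw [map_add, map_smul, map_smul, hJ]
      module
    rwa [h3] at h2
  have h4 : x ^ 2 + y ^ 2 = 0 := by
    by_contra h0
    exact hv ((Submodule.smul_mem_iff _ h0).1 h1)
  constructor <;> nlinarith [sq_nonneg x, sq_nonneg y]

theorem map_injective_of_sq (hJ : ∀ X, J (J X) = -X) : Function.Injective J := by
  intro X Y h
  have := congrArg J h
  rwa [hJ, hJ, neg_inj] at this

/-- On S the square of det J equals (−1) to the power dim S, which must not be negative. -/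
theorem even_finrank [FiniteDimensional ℝ V] (hJ : ∀ X, J (J X) = -X) {S : Submodule ℝ V}
    (hS : ∀ X ∈ S, J X ∈ S) : Even (finrank ℝ S) := by
  have h1 : J.restrict hS * J.restrict hS = (-1 : ℝ) • LinearMap.id := by
    ext X
    simp [hJ]
  have h2 := congrArg LinearMap.det h1
  rw [map_mul, LinearMap.det_smul, LinearMap.det_id, mul_one] at h2
  by_contra hodd
  rw [Nat.not_even_iff_odd] at hodd
  rw [hodd.neg_one_pow] at h2
  nlinarith [mul_self_nonneg (LinearMap.det (J.restrict hS))]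

theorem exists_eq_smul_add [FiniteDimensional ℝ V] {S S' : Submodule ℝ V} (hle : S ≤ S')
    (hf : finrank ℝ S' ≤ finrank ℝ S + 1) {v : V} (hv : v ∈ S') (hvS : v ∉ S) {X : V}
    (hX : X ∈ S') : ∃ x : ℝ, ∃ s ∈ S, X = x • v + s := by
  have h1 : S < S ⊔ Submodule.span ℝ {v} :=
    lt_of_le_not_ge le_sup_left fun h => hvS (h (Submodule.mem_sup_right
      (Submodule.mem_span_singleton_self v)))
  have h2 : S ⊔ Submodule.span ℝ {v} ≤ S' :=
    sup_le hle ((Submodule.span_singleton_le_iff_mem v S').2 hv)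
  have h3 := Submodule.finrank_lt_finrank_of_lt h1
  rw [← Submodule.eq_of_le_of_finrank_le h2 (by omega)] at hX
  obtain ⟨s, hs, w, hw, rfl⟩ := Submodule.mem_sup.1 hX
  obtain ⟨x, rfl⟩ := Submodule.mem_span_singleton.1 hw
  exact ⟨x, s, hs, add_comm _ _⟩

theorem exists_eq_smul_add_smul_add [FiniteDimensional ℝ V] (hJ : ∀ X, J (J X) = -X)
    {S S' : Submodule ℝ V} (hS : ∀ X ∈ S, J X ∈ S) (hS' : ∀ X ∈ S', J X ∈ S') (hle : S ≤ S')
    (hf : finrank ℝ S' ≤ finrank ℝ S + 2) {v : V} (hv : v ∈ S') (hvS : v ∉ S) {X : V}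
    (hX : X ∈ S') : ∃ x y : ℝ, ∃ s ∈ S, X = x • v + y • J v + s := by
  have h1 : S < S ⊔ Submodule.span ℝ {v} :=
    lt_of_le_not_ge le_sup_left fun h => hvS (h (Submodule.mem_sup_right
      (Submodule.mem_span_singleton_self v)))
  have h2 : S ⊔ Submodule.span ℝ {v} ≤ S' :=
    sup_le hle ((Submodule.span_singleton_le_iff_mem v S').2 hv)
  have h3 := Submodule.finrank_lt_finrank_of_lt h1
  have h4 : J v ∉ S ⊔ Submodule.span ℝ {v} := by
    intro h
    obtain ⟨s, hs, w, hw, hsw⟩ := Submodule.mem_sup.1 h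
    obtain ⟨x, rfl⟩ := Submodule.mem_span_singleton.1 hw
    have h5 : (-x) • v + (1 : ℝ) • J v ∈ S := by
      rw [← hsw]
      convert hs using 1
      module
    exact one_ne_zero (smul_add_smul_mem hJ hS hvS h5).2
  obtain ⟨y, t, ht, rfl⟩ := exists_eq_smul_add h2 (by omega) (hS' v hv) h4 hX
  obtain ⟨s, hs, w, hw, rfl⟩ := Submodule.mem_sup.1 ht
  obtain ⟨x, rfl⟩ := Submodule.mem_span_singleton.1 hw
  exact ⟨x, y, s, hs, by module⟩

theorem map_mem_sup_map (hJ : ∀ X, J (J X) = -X) (S : Submodule ℝ V) :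
    ∀ X ∈ S ⊔ S.map J, J X ∈ S ⊔ S.map J := by
  intro X hX
  obtain ⟨a, ha, b, ⟨c, hc, rfl⟩, rfl⟩ := Submodule.mem_sup.1 hX
  rw [map_add, hJ]
  exact Submodule.add_mem _ (Submodule.mem_sup_right ⟨a, ha, rfl⟩)
    (Submodule.mem_sup_left (Submodule.neg_mem _ hc))

theorem map_mem_inf_map (hJ : ∀ X, J (J X) = -X) (S : Submodule ℝ V) :
    ∀ X ∈ S ⊓ S.map J, J X ∈ S ⊓ S.map J := by
  rintro X ⟨h1, ⟨c, hc, rfl⟩⟩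
  refine ⟨?_, ⟨J c, h1, rfl⟩⟩
  rw [hJ]
  exact Submodule.neg_mem _ hc

/-- Coordinates with respect to a spanning family of six vectors in dimension six. -/
theorem exists_coordinates (hdim : finrank ℝ V = 6) (b : Fin 6 → V)
    (hspan : ∀ X, ∃ x : Fin 6 → ℝ, X = x 0 • b 0 + x 1 • b 1 + x 2 • b 2 + x 3 • b 3 +
      x 4 • b 4 + x 5 • b 5) :
    ∃ f : Fin 6 → Dual ℝ V, (∀ X, X = f 0 X • b 0 + f 1 X • b 1 + f 2 X • b 2 + f 3 X • b 3 +
      f 4 X • b 4 + f 5 X • b 5) ∧ ∀ i j, f i (b j) = if j = i then 1 else 0 := by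
  have htop : ⊤ ≤ Submodule.span ℝ (Set.range b) := by
    intro X _
    obtain ⟨x, rfl⟩ := hspan X
    have h : ∀ i, x i • b i ∈ Submodule.span ℝ (Set.range b) := fun i =>
      Submodule.smul_mem _ _ (Submodule.subset_span ⟨i, rfl⟩)
    exact Submodule.add_mem _ (Submodule.add_mem _ (Submodule.add_mem _ (Submodule.add_mem _
      (Submodule.add_mem _ (h 0) (h 1)) (h 2)) (h 3)) (h 4)) (h 5)
  let B := basisOfTopLeSpanOfCardEqFinrank b htop (by simp [hdim])
  have hB : ∀ i, B i = b i := fun i => by simp [B]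
  refine ⟨fun i => B.coord i, fun X => ?_, fun i j => ?_⟩
  · have := B.sum_repr X
    simp only [Fin.sum_univ_six, hB] at this
    exact this.symm
  · rw [← hB, Basis.coord_apply, Basis.repr_self, Finsupp.single_apply]

end ComplexSubspaces

/-! ### The J-invariant flag attached to the derived algebra. -/

section Structure

variable {g : Type*} [LieRing g] [LieAlgebra ℝ g] {J : g →ₗ[ℝ] g}

/-- When a + Jb is bracketed with c + Jd, only [Jb, Jd] has no argument in the k-th term, and
integrability rewrites it through [b, d], [Jb, d] and [b, Jd]. -/
theorem lcSub_one_le_of_sup_map_eq_top (hJ : IsComplexStructure J) {k : ℕ}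
    (h : lcSub g k ⊔ (lcSub g k).map J = ⊤) :
    lcSub g 1 ≤ lcSub g (k + 1) ⊔ (lcSub g (k + 1)).map J := by
  refine (lowerCentralSeries_succ_le_iff 0 _).2 fun X Y _ => ?_
  have hX : X ∈ lcSub g k ⊔ (lcSub g k).map J := h ▸ Submodule.mem_top
  have hY : Y ∈ lcSub g k ⊔ (lcSub g k).map J := h ▸ Submodule.mem_top
  obtain ⟨a, ha, _, ⟨b, hb, rfl⟩, rfl⟩ := Submodule.mem_sup.1 hX
  obtain ⟨c, hc, _, ⟨d, hd, rfl⟩, rfl⟩ := Submodule.mem_sup.1 hY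
  have h1 : ⁅a + J b, c + J d⁆ = (⁅a, c⁆ + ⁅a, J d⁆ + ⁅J b, c⁆ + ⁅b, d⁆) +
      J (⁅J b, d⁆ + ⁅b, J d⁆) := by
    rw [add_lie, lie_add, lie_add, hJ.integrable b d, map_add]
    abel
  rw [h1]
  refine Submodule.add_mem _ (Submodule.mem_sup_left ?_) (Submodule.mem_sup_right ⟨_, ?_, rfl⟩)
  · exact Submodule.add_mem _ (Submodule.add_mem _ (Submodule.add_mem _
      (lie_mem_lcSub_succ _ hc) (lie_mem_lcSub_succ' _ ha)) (lie_mem_lcSub_succ _ hc))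
      (lie_mem_lcSub_succ _ hd)
  · exact Submodule.add_mem _ (lie_mem_lcSub_succ _ hd) (lie_mem_lcSub_succ' _ hb)

/-- The derived algebra and its image under `J` do not span a nonzero nilpotent Lie algebra. -/
theorem sup_map_ne_top [Nontrivial g] (hnil : LieRing.IsNilpotent g) (hJ : IsComplexStructure J) :
    lcSub g 1 ⊔ (lcSub g 1).map J ≠ ⊤ := by
  intro h
  have key : ∀ k, lcSub g k ⊔ (lcSub g k).map J = ⊤ := by
    intro k
    induction k with
    | zero => rw [show lcSub g 0 = ⊤ from rfl, top_sup_eq]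
    | succ k ih =>
      have h1 := lcSub_one_le_of_sup_map_eq_top hJ ih
      rw [eq_top_iff, ← h]
      refine sup_le h1 ?_
      rintro _ ⟨X, hX, rfl⟩
      exact map_mem_sup_map hJ.sq _ X (h1 hX)
  obtain ⟨k, hk⟩ := exists_lcSub_eq_bot hnil
  have := key k
  rw [hk, Submodule.map_bot, sup_bot_eq] at this
  exact bot_ne_top this

variable [FiniteDimensional ℝ g]

/-- The sum is even-dimensional, at least 3 and less than 6, hence 4; the intersection then has
dimension 3 + 3 − 4. -/
theorem finrank_sup_map_and_inf_map (hdim : finrank ℝ g = 6) (hnil : LieRing.IsNilpotent g)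
    (hJ : IsComplexStructure J) (h1 : finrank ℝ (lcSub g 1) = 3) :
    finrank ℝ ↥(lcSub g 1 ⊔ (lcSub g 1).map J) = 4 ∧
      finrank ℝ ↥(lcSub g 1 ⊓ (lcSub g 1).map J) = 2 := by
  have : Nontrivial g := Module.nontrivial_of_finrank_pos (R := ℝ) (by omega)
  have hlt := Submodule.finrank_lt (sup_map_ne_top hnil hJ)
  have heven := even_finrank hJ.sq (map_mem_sup_map hJ.sq (lcSub g 1))
  have hle := Submodule.finrank_mono
    (le_sup_left : lcSub g 1 ≤ lcSub g 1 ⊔ (lcSub g 1).map J)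
  have hsum := Submodule.finrank_sup_add_finrank_inf_eq (lcSub g 1) ((lcSub g 1).map J)
  have hmap : finrank ℝ ((lcSub g 1).map J) = finrank ℝ (lcSub g 1) :=
    (LinearEquiv.finrank_eq (Submodule.equivMapOfInjective J (map_injective_of_sq hJ.sq) _)).symm
  obtain ⟨r, hr⟩ := heven
  omega

end Structure

/-! ### The two cases of the classification, according to the position of [g, [g, g]]. -/

section Cases

variable {g : Type*} [LieRing g] [LieAlgebra ℝ g] {J : g →ₗ[ℝ] g}

/-- If `[g, [g, g]]` lies in the largest `J`-invariant subspace of `[g, g]`, then the latter is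
central. -/
theorem lie_eq_zero_of_lcSub_two_le [FiniteDimensional ℝ g]
    (hnil : LieRing.IsNilpotent g) (hJ : IsComplexStructure J)
    (hL : finrank ℝ ↥(lcSub g 1 ⊓ (lcSub g 1).map J) = 2)
    (h2 : lcSub g 2 ≤ lcSub g 1 ⊓ (lcSub g 1).map J) {l : g}
    (hl : l ∈ lcSub g 1 ⊓ (lcSub g 1).map J) (T : g) : ⁅T, l⁆ = 0 := by
  by_cases hbot : lcSub g 2 = ⊥
  · have := lie_mem_lcSub_succ T hl.1
    rwa [hbot, Submodule.mem_bot] at this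
  obtain ⟨z, hz, hz0, hcen⟩ := exists_central_mem_lcSub hnil hbot
  have hinv := map_mem_inf_map hJ.sq (lcSub g 1)
  have hspan : ∀ X ∈ lcSub g 1 ⊓ (lcSub g 1).map J, ∃ x y : ℝ, X = x • z + y • J z := by
    intro X hX
    obtain ⟨x, y, s, hs, rfl⟩ := exists_eq_smul_add_smul_add (S := ⊥) hJ.sq (by simp) hinv bot_le
      (by rw [hL, finrank_bot]) (h2 hz) (by simpa using hz0) hX
    rw [Submodule.mem_bot] at hs
    exact ⟨x, y, by rw [hs, add_zero]⟩
  have hJz : ∀ T : g, ⁅T, J z⁆ = 0 := by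
    intro T
    by_contra hw
    obtain ⟨x, y, hxy⟩ := hspan _ (h2 (lie_mem_lcSub_succ T (hinv z (h2 hz)).1))
    have h3 : ⁅J T, J z⁆ = x • J z - y • z := by
      rw [hJ.integrable, hcen, hcen, hxy, map_add, map_smul, map_smul, hJ.sq, map_zero]
      module
    -- With [T, Jz] = xz + yJz and z central, integrability gives [JT, Jz] = xJz − yz. This
    -- combination of T and JT has Jz as an eigenvector, which nilpotency forbids unless x = y = 0.
    have h4 : ⁅y • T + x • J T, J z⁆ = (x ^ 2 + y ^ 2) • J z := by
      rw [add_lie, smul_lie, smul_lie, h3, hxy]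
      module
    have hne : x ^ 2 + y ^ 2 ≠ 0 := by
      intro h0
      have hx : x = 0 := by nlinarith [sq_nonneg x, sq_nonneg y]
      have hy : y = 0 := by nlinarith [sq_nonneg x, sq_nonneg y]
      apply hw
      rw [hxy, hx, hy]
      module
    have h5 := eq_zero_of_lie_eq_smul hnil hne h4
    exact hz0 (map_injective_of_sq hJ.sq (by rw [h5, map_zero]))
  obtain ⟨x, y, rfl⟩ := hspan l hl
  rw [lie_add, lie_smul, lie_smul, hcen, hJz]
  module

/-- The structure equations of `g` from the brackets of the vectors of a frame. -/
theorem exists_nonempty_equiv_of_pencil_frame (hdim : finrank ℝ g = 6) (b : Fin 6 → g)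
    (hspan : ∀ X, ∃ x : Fin 6 → ℝ, X = x 0 • b 0 + x 1 • b 1 + x 2 • b 2 + x 3 • b 3 +
      x 4 • b 4 + x 5 • b 5) (h01 : ⁅b 0, b 1⁆ = b 3) (h23 : ⁅b 2, b 3⁆ = 0)
    (h4 : ∀ T : g, ⁅T, b 4⁆ = 0) (h5 : ∀ T : g, ⁅T, b 5⁆ = 0) (hb4 : b 4 ∈ lcSub g 1)
    (hb5 : b 5 ∈ lcSub g 1) {M N : Fin 4 → ℝ} (h02 : ⁅b 0, b 2⁆ = M 0 • b 4 + N 0 • b 5)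
    (h03 : ⁅b 0, b 3⁆ = M 1 • b 4 + N 1 • b 5) (h12 : ⁅b 1, b 2⁆ = M 2 • b 4 + N 2 • b 5)
    (h13 : ⁅b 1, b 3⁆ = M 3 • b 4 + N 3 • b 5) : ∃ n, Nonempty (g ≃ₗ⁅ℝ⁆ ListedAlgebra n) := by
  obtain ⟨f, hf, hfb⟩ := exists_coordinates hdim b hspan
  have hlie : ∀ X Y : g, ⁅X, Y⁆ = wedgeValue f X Y 0 1 • b 3 +
      pencilForm M (wedgeValue f X Y) • b 4 + pencilForm N (wedgeValue f X Y) • b 5 := by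
    intro X Y
    have hexp : ∀ x0 x1 x2 x3 x4 x5 y0 y1 y2 y3 y4 y5 : ℝ,
        ⁅x0 • b 0 + x1 • b 1 + x2 • b 2 + x3 • b 3 + x4 • b 4 + x5 • b 5,
          y0 • b 0 + y1 • b 1 + y2 • b 2 + y3 • b 3 + y4 • b 4 + y5 • b 5⁆ =
        (x0 * y1 - y0 * x1) • b 3 +
        (M 0 * (x0 * y2 - y0 * x2) + M 1 * (x0 * y3 - y0 * x3) + M 2 * (x1 * y2 - y1 * x2) +
          M 3 * (x1 * y3 - y1 * x3)) • b 4 +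
        (N 0 * (x0 * y2 - y0 * x2) + N 1 * (x0 * y3 - y0 * x3) + N 2 * (x1 * y2 - y1 * x2) +
          N 3 * (x1 * y3 - y1 * x3)) • b 5 := by
      intro x0 x1 x2 x3 x4 x5 y0 y1 y2 y3 y4 y5
      have h4' : ∀ T : g, ⁅b 4, T⁆ = 0 := fun T => by rw [← lie_skew, h4, neg_zero]
      have h5' : ∀ T : g, ⁅b 5, T⁆ = 0 := fun T => by rw [← lie_skew, h5, neg_zero]
      have h10 : ⁅b 1, b 0⁆ = -b 3 := by rw [← lie_skew, h01]
      have h32 : ⁅b 3, b 2⁆ = 0 := by rw [← lie_skew, h23, neg_zero]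
      have h20 : ⁅b 2, b 0⁆ = -(M 0 • b 4 + N 0 • b 5) := by rw [← lie_skew, h02]
      have h30 : ⁅b 3, b 0⁆ = -(M 1 • b 4 + N 1 • b 5) := by rw [← lie_skew, h03]
      have h21 : ⁅b 2, b 1⁆ = -(M 2 • b 4 + N 2 • b 5) := by rw [← lie_skew, h12]
      have h31 : ⁅b 3, b 1⁆ = -(M 3 • b 4 + N 3 • b 5) := by rw [← lie_skew, h13]
      simp only [add_lie, lie_add, smul_lie, lie_smul, lie_self, h4, h5, h4', h5', h01, h10, h23,
        h32, h02, h20, h03, h30, h12, h21, h13, h31]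
      module
    have := hexp (f 0 X) (f 1 X) (f 2 X) (f 3 X) (f 4 X) (f 5 X)
      (f 0 Y) (f 1 Y) (f 2 Y) (f 3 Y) (f 4 Y) (f 5 Y)
    rw [← hf, ← hf] at this
    exact this
  -- The signs and κ = −1 come from dσ(X, Y) = −σ([X, Y]).
  have hpencil : HasPencil g (-M) (-N) := by
    refine ⟨f, fun X hX => ?_, -1, by norm_num, fun X Y => ?_⟩
    · rw [hf X]
      simp [hX]
    · rw [hlie]
      simp [hfb, pencilForm]
      constructor <;> ring
  refine hpencil.exists_nonempty_equiv hdim fun s t hst => ?_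
  -- A linear relation between M and N makes this 1-form closed, so it vanishes on [g, g], which
  -- contains `b 4` and `b 5`.
  have hker : lcSub g 1 ≤ LinearMap.ker (s • f 4 + t • f 5) := by
    refine (lowerCentralSeries_succ_le_iff 0 _).2 fun X Y _ => ?_
    have e : ∀ i, s * M i + t * N i = 0 := by
      intro i
      have := congrFun hst i
      simp at this
      linarith
    rw [LinearMap.mem_ker, hlie]
    simp [hfb, pencilForm]
    linear_combination e 0 * wedgeValue f X Y 0 2 + e 1 * wedgeValue f X Y 0 3 +
      e 2 * wedgeValue f X Y 1 2 + e 3 * wedgeValue f X Y 1 3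
  have k4 := hker hb4
  have k5 := hker hb5
  rw [LinearMap.mem_ker] at k4 k5
  simp [hfb] at k4 k5
  exact ⟨k4, k5⟩

/-- The case in which `[g, [g, g]]` lies in the largest `J`-invariant subspace of `[g, g]`. -/
theorem exists_nonempty_equiv_of_lcSub_two_le [FiniteDimensional ℝ g]
    (hdim : finrank ℝ g = 6) (hnil : LieRing.IsNilpotent g) (hJ : IsComplexStructure J) (h1 : finrank ℝ (lcSub g 1) = 3)
    (h2 : lcSub g 2 ≤ lcSub g 1 ⊓ (lcSub g 1).map J) :
    ∃ n, Nonempty (g ≃ₗ⁅ℝ⁆ ListedAlgebra n) := by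
  have : Nontrivial g := Module.nontrivial_of_finrank_pos (R := ℝ) (by omega)
  obtain ⟨hK, hL⟩ := finrank_sup_map_and_inf_map hdim hnil hJ h1
  have hcen : ∀ l ∈ lcSub g 1 ⊓ (lcSub g 1).map J, ∀ T : g, ⁅T, l⁆ = 0 :=
    fun l hl T => lie_eq_zero_of_lcSub_two_le hnil hJ hL h2 hl T
  have hLinv := map_mem_inf_map hJ.sq (lcSub g 1)
  have hKinv := map_mem_sup_map hJ.sq (lcSub g 1)
  have hne := sup_map_ne_top hnil hJ
  have hJL : ∀ T : g, ∀ X ∈ lcSub g 1, ⁅T, J X⁆ ∈ lcSub g 1 ⊓ (lcSub g 1).map J := by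
    intro T X hX
    refine ⟨lie_mem_lowerCentralSeries_one T (J X), ?_⟩
    -- Writing T = J(−JT), integrability expresses [T, JX] as an element of [g, [g, g]] plus J of an
    -- element of [g, g].
    have h3 := hJ.integrable (-J T) X
    rw [map_neg, hJ.sq, neg_neg, add_assoc, ← map_add] at h3
    rw [h3]
    exact Submodule.add_mem _ (h2 (lie_mem_lcSub_succ _ hX)).2
      ⟨_, Submodule.add_mem _ (lie_mem_lowerCentralSeries_one _ _)
        (lie_mem_lowerCentralSeries_one _ _), rfl⟩
  have hlL : ∀ T : g, ∀ X ∈ lcSub g 1, ⁅T, X⁆ ∈ lcSub g 1 ⊓ (lcSub g 1).map J :=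
    fun T X hX => h2 (lie_mem_lcSub_succ T hX)
  have hKL : ∀ T : g, ∀ X ∈ lcSub g 1 ⊔ (lcSub g 1).map J,
      ⁅T, X⁆ ∈ lcSub g 1 ⊓ (lcSub g 1).map J := by
    intro T X hX
    obtain ⟨a, ha, _, ⟨b, hb, rfl⟩, rfl⟩ := Submodule.mem_sup.1 hX
    rw [lie_add]
    exact Submodule.add_mem _ (hlL T a ha) (hJL T b hb)
  have hLle : lcSub g 1 ⊓ (lcSub g 1).map J ≤ lcSub g 1 ⊔ (lcSub g 1).map J :=
    inf_le_left.trans le_sup_left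
  obtain ⟨T, hT⟩ : ∃ T, T ∉ lcSub g 1 ⊔ (lcSub g 1).map J := by
    by_contra! hall
    exact hne (eq_top_iff.2 fun X _ => hall X)
  have hdecT : ∀ X, ∃ x y : ℝ, ∃ k ∈ lcSub g 1 ⊔ (lcSub g 1).map J, X = x • T + y • J T + k :=
    fun X => exists_eq_smul_add_smul_add (S' := ⊤) hJ.sq hKinv (by simp) le_top
      (by rw [hK, finrank_top, hdim]) Submodule.mem_top hT Submodule.mem_top
  have hB1 : ⁅T, J T⁆ ∈ lcSub g 1 := lie_mem_lowerCentralSeries_one _ _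
  -- Modulo L the subspace K is central, so [T, JT] spans [g, g] modulo L; as 3 > 2, it cannot lie
  -- in L.
  have hBL : ⁅T, J T⁆ ∉ lcSub g 1 ⊓ (lcSub g 1).map J := by
    intro hB
    have hle : lcSub g 1 ≤ lcSub g 1 ⊓ (lcSub g 1).map J := by
      refine (lowerCentralSeries_succ_le_iff 0 _).2 fun X Y _ => ?_
      obtain ⟨x, y, k, hk, rfl⟩ := hdecT X
      obtain ⟨x', y', k', hk', rfl⟩ := hdecT Y
      have : ⁅x • T + y • J T + k, x' • T + y' • J T + k'⁆ = (x * y' - y * x') • ⁅T, J T⁆ +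
          ⁅x • T + y • J T + k, k'⁆ - ⁅x' • T + y' • J T, k⁆ := by
        rw [lie_add, add_lie _ k, ← lie_skew k (x' • T + y' • J T)]
        simp only [add_lie, lie_add, smul_lie, lie_smul, lie_self, ← lie_skew (J T) T]
        module
      rw [this]
      exact Submodule.sub_mem _ (Submodule.add_mem _ (Submodule.smul_mem _ _ hB) (hKL _ _ hk'))
        (hKL _ _ hk)
    have := Submodule.finrank_mono hle
    omega
  have hdecB : ∀ X ∈ lcSub g 1 ⊔ (lcSub g 1).map J, ∃ x y : ℝ,
      ∃ l ∈ lcSub g 1 ⊓ (lcSub g 1).map J, X = x • ⁅T, J T⁆ + y • J ⁅T, J T⁆ + l :=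
    fun X hX => exists_eq_smul_add_smul_add hJ.sq hLinv hKinv hLle (by omega)
      (Submodule.mem_sup_left hB1) hBL hX
  obtain ⟨n, hn, hn0⟩ := Submodule.exists_mem_ne_zero_of_ne_bot
    (p := lcSub g 1 ⊓ (lcSub g 1).map J) fun h => by rw [h, finrank_bot] at hL; omega
  have hdecn : ∀ X ∈ lcSub g 1 ⊓ (lcSub g 1).map J, ∃ x y : ℝ, X = x • n + y • J n := by
    intro X hX
    obtain ⟨x, y, s, hs, rfl⟩ := exists_eq_smul_add_smul_add (S := ⊥) hJ.sq (by simp) hLinv bot_le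
      (by rw [hL, finrank_bot]) hn (by simpa using hn0) hX
    rw [Submodule.mem_bot] at hs
    exact ⟨x, y, by rw [hs, add_zero]⟩
  have hcen' : ∀ l ∈ lcSub g 1 ⊓ (lcSub g 1).map J, ∀ T : g, ⁅l, T⁆ = 0 := fun l hl T => by
    rw [← lie_skew, hcen l hl, neg_zero]
  obtain ⟨a0, c0, h02⟩ := hdecn _ (hJL T _ hB1)
  obtain ⟨a1, c1, h03⟩ := hdecn _ (hlL T _ hB1)
  obtain ⟨a2, c2, h12⟩ := hdecn _ (hJL (J T) _ hB1)
  obtain ⟨a3, c3, h13⟩ := hdecn _ (hlL (J T) _ hB1)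
  have h23 : ⁅J ⁅T, J T⁆, ⁅T, J T⁆⁆ = 0 := by
    have e1 : ⁅⁅J ⁅T, J T⁆, T⁆, J T⁆ = 0 := by
      rw [← lie_skew _ T, neg_lie, hcen' _ (hJL T _ hB1), neg_zero]
    have e2 : ⁅T, ⁅J ⁅T, J T⁆, J T⁆⁆ = 0 := by
      rw [← lie_skew _ (J T), lie_neg, hcen _ (hJL (J T) _ hB1), neg_zero]
    rw [leibniz_lie, e1, e2, add_zero]
  refine exists_nonempty_equiv_of_pencil_frame hdim
    ![T, J T, J ⁅T, J T⁆, ⁅T, J T⁆, n, J n] ?_ rfl h23 (hcen _ hn) (hcen _ (hLinv _ hn)) hn.1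
    (hLinv _ hn).1 (M := ![a0, a1, a2, a3]) (N := ![c0, c1, c2, c3]) h02 h03 h12 h13
  intro X
  obtain ⟨x, y, k, hk, rfl⟩ := hdecT X
  obtain ⟨x', y', l, hl, rfl⟩ := hdecB k hk
  obtain ⟨x'', y'', rfl⟩ := hdecn l hl
  refine ⟨![x, y, y', x', x'', y''], ?_⟩
  simp
  module

/-- The structure equations of the last listed algebra from the brackets of a frame. -/
theorem nonempty_equiv_of_frame (hdim : finrank ℝ g = 6) (b : Fin 6 → g)
    (hspan : ∀ X, ∃ x : Fin 6 → ℝ, X = x 0 • b 0 + x 1 • b 1 + x 2 • b 2 + x 3 • b 3 +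
      x 4 • b 4 + x 5 • b 5) {α β γ c : ℝ} (hc : c ≠ 0)
    (h01 : ⁅b 0, b 1⁆ = α • b 5 + β • b 3 + γ • b 4) (h02 : ⁅b 0, b 2⁆ = b 3)
    (h12 : ⁅b 1, b 2⁆ = b 4) (h03 : ⁅b 0, b 3⁆ = c • b 5) (h14 : ⁅b 1, b 4⁆ = c • b 5)
    (h04 : ⁅b 0, b 4⁆ = 0) (h13 : ⁅b 1, b 3⁆ = 0) (h23 : ⁅b 2, b 3⁆ = 0) (h24 : ⁅b 2, b 4⁆ = 0)
    (h34 : ⁅b 3, b 4⁆ = 0) (h5 : ∀ T : g, ⁅T, b 5⁆ = 0) :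
    Nonempty (g ≃ₗ⁅ℝ⁆ ListedAlgebra 8) := by
  obtain ⟨f, hf, hfb⟩ := exists_coordinates hdim b hspan
  have hlie : ∀ X Y : g, ⁅X, Y⁆ =
      (wedgeValue f X Y 0 2 + β * wedgeValue f X Y 0 1) • b 3 +
      (wedgeValue f X Y 1 2 + γ * wedgeValue f X Y 0 1) • b 4 +
      (α * wedgeValue f X Y 0 1 + c * (wedgeValue f X Y 0 3 + wedgeValue f X Y 1 4)) • b 5 := by
    intro X Y
    have hexp : ∀ x0 x1 x2 x3 x4 x5 y0 y1 y2 y3 y4 y5 : ℝ,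
        ⁅x0 • b 0 + x1 • b 1 + x2 • b 2 + x3 • b 3 + x4 • b 4 + x5 • b 5,
          y0 • b 0 + y1 • b 1 + y2 • b 2 + y3 • b 3 + y4 • b 4 + y5 • b 5⁆ =
        ((x0 * y2 - y0 * x2) + β * (x0 * y1 - y0 * x1)) • b 3 +
        ((x1 * y2 - y1 * x2) + γ * (x0 * y1 - y0 * x1)) • b 4 +
        (α * (x0 * y1 - y0 * x1) + c * ((x0 * y3 - y0 * x3) + (x1 * y4 - y1 * x4))) • b 5 := by
      intro x0 x1 x2 x3 x4 x5 y0 y1 y2 y3 y4 y5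
      have h5' : ∀ T : g, ⁅b 5, T⁆ = 0 := fun T => by rw [← lie_skew, h5, neg_zero]
      have h10 : ⁅b 1, b 0⁆ = -(α • b 5 + β • b 3 + γ • b 4) := by rw [← lie_skew, h01]
      have h20 : ⁅b 2, b 0⁆ = -b 3 := by rw [← lie_skew, h02]
      have h21 : ⁅b 2, b 1⁆ = -b 4 := by rw [← lie_skew, h12]
      have h30 : ⁅b 3, b 0⁆ = -(c • b 5) := by rw [← lie_skew, h03]
      have h41 : ⁅b 4, b 1⁆ = -(c • b 5) := by rw [← lie_skew, h14]
      have h40 : ⁅b 4, b 0⁆ = 0 := by rw [← lie_skew, h04, neg_zero]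
      have h31 : ⁅b 3, b 1⁆ = 0 := by rw [← lie_skew, h13, neg_zero]
      have h32 : ⁅b 3, b 2⁆ = 0 := by rw [← lie_skew, h23, neg_zero]
      have h42 : ⁅b 4, b 2⁆ = 0 := by rw [← lie_skew, h24, neg_zero]
      have h43 : ⁅b 4, b 3⁆ = 0 := by rw [← lie_skew, h34, neg_zero]
      simp only [add_lie, lie_add, smul_lie, lie_smul, lie_self, h5, h5', h01, h10, h02, h20, h12,
        h21, h03, h30, h14, h41, h04, h40, h13, h31, h23, h32, h24, h42, h34, h43]
      module
    have := hexp (f 0 X) (f 1 X) (f 2 X) (f 3 X) (f 4 X) (f 5 X)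
      (f 0 Y) (f 1 Y) (f 2 Y) (f 3 Y) (f 4 Y) (f 5 Y)
    rw [← hf, ← hf] at this
    exact this
  -- The corrections by β and γ absorb the components of [b₀, b₁] along b₃ and b₄, and the one by
  -- α/c its component along b₅.
  refine nonempty_equiv_of_coframe hdim 8 ![f 0, f 2 + β • f 1 - γ • f 0, f 1,
    -(f 3 + (α / c) • f 1), f 4, c⁻¹ • f 5] (fun X hX => ?_) fun X Y k => ?_
  · have k0 : f 0 X = 0 := hX 0
    have k1 := hX 1
    have k2 : f 1 X = 0 := hX 2
    have k3 := hX 3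
    have k4 : f 4 X = 0 := hX 4
    have k5 := hX 5
    simp [k0, k2] at k1 k3
    simp [hc] at k5
    rw [hf X]
    simp [k0, k1, k2, k3, k4, k5]
  · rw [hlie]
    fin_cases k <;> simp [hfb, structureValues, wedgeValue] <;> field_simp <;> ring

/-- If `[g, [g, g]]` does not lie in the largest `J`-invariant subspace of `[g, g]`, then it has
dimension one. -/
theorem lcSub_two_le_span [FiniteDimensional ℝ g]
    (hnil : LieRing.IsNilpotent g) (hJ : IsComplexStructure J)
    (h1 : finrank ℝ (lcSub g 1) = 3) (hL : finrank ℝ ↥(lcSub g 1 ⊓ (lcSub g 1).map J) = 2) {n : g}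
    (hn : n ∈ lcSub g 2) (hnJ : J n ∉ lcSub g 1) : lcSub g 2 ≤ Submodule.span ℝ {n} := by
  have hn1 := lcSub_succ_le 1 hn
  have hLinv := map_mem_inf_map hJ.sq (lcSub g 1)
  have hnL : n ∉ lcSub g 1 ⊓ (lcSub g 1).map J := fun h => hnJ (hLinv n h).1
  intro y hy
  by_contra hyn
  have hn0 : n ≠ 0 := by
    rintro rfl
    exact hnJ (by simp)
  have hbot : lcSub g 2 ≠ ⊥ := fun h => hn0 (by simpa [h] using hn)
  have hbot1 : lcSub g 1 ≠ ⊥ := fun h => hbot (eq_bot_iff.2 ((lcSub_succ_le 1).trans h.le))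
  have hlt1 : finrank ℝ (lcSub g 2) < finrank ℝ (lcSub g 1) := finrank_lcSub_succ_lt hnil hbot1
  have hlt2 : finrank ℝ (lcSub g 3) < finrank ℝ (lcSub g 2) := finrank_lcSub_succ_lt hnil hbot
  have h22 : finrank ℝ (lcSub g 2) = 2 := by
    have hspan : Submodule.span ℝ {n} < lcSub g 2 :=
      lt_of_le_not_ge ((Submodule.span_singleton_le_iff_mem _ _).2 hn) fun h => hyn (h hy)
    have := Submodule.finrank_lt_finrank_of_lt hspan
    rw [finrank_span_singleton hn0] at this
    omega
  obtain ⟨x, l, hl, hyl⟩ := exists_eq_smul_add (S := lcSub g 1 ⊓ (lcSub g 1).map J) inf_le_left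
    (by omega) hn1 hnL (lcSub_succ_le 1 hy)
  have hl0 : l ≠ 0 := by
    rintro rfl
    exact hyn (Submodule.mem_span_singleton.2 ⟨x, by rw [hyl, add_zero]⟩)
  have hl2 : l ∈ lcSub g 2 := by
    have : l = y - x • n := by
      rw [hyl]
      module
    rw [this]
    exact Submodule.sub_mem _ hy (Submodule.smul_mem _ _ hn)
  have hdec : ∀ Y ∈ lcSub g 1, ∃ (r : ℝ), ∃ z ∈ lcSub g 2, Y = z + r • J l := by
    intro Y hY
    obtain ⟨x, k, hk, rfl⟩ := exists_eq_smul_add (S := lcSub g 1 ⊓ (lcSub g 1).map J) inf_le_left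
      (by omega) hn1 hnL hY
    obtain ⟨u, v, s, hs, rfl⟩ := exists_eq_smul_add_smul_add (S := ⊥) hJ.sq (by simp) hLinv bot_le
      (by rw [hL, finrank_bot]) hl (by simpa using hl0) hk
    rw [Submodule.mem_bot] at hs
    refine ⟨v, x • n + u • l, Submodule.add_mem _ (Submodule.smul_mem _ _ hn)
      (Submodule.smul_mem _ _ hl2), ?_⟩
    rw [hs]
    module
  -- If g'' had dimension 2, it would contain some l ≠ 0 of L, and g' = g'' + ℝJl. Integrability
  -- then makes g'' + J[g, g''] J-invariant. Its dimension is even and at most 2 + 1, so it equals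
  -- g'', contradicting that Jn is not in g'.
  have hQ2 : lcSub g 2 ≤ (lcSub g 2 ⊔ (lcSub g 3).map J).comap J := by
    refine (lowerCentralSeries_succ_le_iff 1 _).2 fun T Y hY => ?_
    obtain ⟨r, z, hz, rfl⟩ := hdec Y hY
    rw [Submodule.mem_comap]
    have : J ⁅T, z + r • J l⁆ = (r • (⁅J T, J l⁆ - ⁅T, l⁆)) + J (⁅T, z⁆ - r • ⁅J T, l⁆) := by
      rw [hJ.integrable, lie_add, lie_smul]
      simp only [map_add, map_sub, map_smul]
      module
    rw [this]
    refine Submodule.add_mem _ (Submodule.mem_sup_left (Submodule.smul_mem _ _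
      (Submodule.sub_mem _ (lie_mem_lcSub_succ _ (hLinv l hl).1) (lie_mem_lcSub_succ _ hl.1))))
      (Submodule.mem_sup_right ⟨_, Submodule.sub_mem _ (lie_mem_lcSub_succ _ hz)
        (Submodule.smul_mem _ _ (lie_mem_lcSub_succ _ hl2)), rfl⟩)
  have hQinv : ∀ X ∈ lcSub g 2 ⊔ (lcSub g 3).map J, J X ∈ lcSub g 2 ⊔ (lcSub g 3).map J := by
    intro X hX
    obtain ⟨a, ha, _, ⟨b, hb, rfl⟩, rfl⟩ := Submodule.mem_sup.1 hX
    rw [map_add, hJ.sq]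
    exact Submodule.add_mem _ (hQ2 ha)
      (Submodule.mem_sup_left (Submodule.neg_mem _ (lcSub_succ_le 2 hb)))
  obtain ⟨r, hr⟩ := even_finrank hJ.sq hQinv
  have hle := Submodule.finrank_add_le_finrank_add_finrank (lcSub g 2) ((lcSub g 3).map J)
  have hle3 := Submodule.finrank_map_le J (lcSub g 3)
  have hQeq : lcSub g 2 = lcSub g 2 ⊔ (lcSub g 3).map J :=
    Submodule.eq_of_le_of_finrank_le le_sup_left (by omega)
  rw [← hQeq] at hQinv
  exact hnJ (lcSub_succ_le 1 (hQinv n hn))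

/-- The case in which `[g, [g, g]]` does not lie in the largest `J`-invariant subspace of
`[g, g]`. -/
theorem nonempty_equiv_of_not_lcSub_two_le [FiniteDimensional ℝ g]
    (hdim : finrank ℝ g = 6) (hnil : LieRing.IsNilpotent g) (hJ : IsComplexStructure J) (h1 : finrank ℝ (lcSub g 1) = 3)
    (h2 : ¬ lcSub g 2 ≤ lcSub g 1 ⊓ (lcSub g 1).map J) :
    Nonempty (g ≃ₗ⁅ℝ⁆ ListedAlgebra 8) := by
  have : Nontrivial g := Module.nontrivial_of_finrank_pos (R := ℝ) (by omega)
  obtain ⟨hK, hL⟩ := finrank_sup_map_and_inf_map hdim hnil hJ h1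
  have hLinv := map_mem_inf_map hJ.sq (lcSub g 1)
  have hKinv := map_mem_sup_map hJ.sq (lcSub g 1)
  have hne := sup_map_ne_top hnil hJ
  have hLle : lcSub g 1 ⊓ (lcSub g 1).map J ≤ lcSub g 1 ⊔ (lcSub g 1).map J :=
    inf_le_left.trans le_sup_left
  obtain ⟨n, hn, hnL⟩ := SetLike.not_le_iff_exists.1 h2
  have hn1 := lcSub_succ_le 1 hn
  have hnJ : J n ∉ lcSub g 1 := by
    intro h
    refine hnL ⟨hn1, -J n, Submodule.neg_mem _ h, ?_⟩
    rw [map_neg, hJ.sq, neg_neg]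
  have hn0 : n ≠ 0 := by
    rintro rfl
    exact hnJ (by simp)
  have h2n : ∀ X ∈ lcSub g 2, ∃ r : ℝ, X = r • n := by
    intro X hX
    obtain ⟨r, hr⟩ := Submodule.mem_span_singleton.1 (lcSub_two_le_span hnil hJ h1 hL hn hnJ hX)
    exact ⟨r, hr.symm⟩
  have hdec1 : ∀ X ∈ lcSub g 1, ∃ r : ℝ, ∃ l ∈ lcSub g 1 ⊓ (lcSub g 1).map J, X = r • n + l :=
    fun X hX => exists_eq_smul_add inf_le_left (by omega) hn1 hnL hX
  have hcen : ∀ T : g, ⁅T, n⁆ = 0 := by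
    intro T
    obtain ⟨r, hr⟩ := h2n _ (lie_mem_lcSub_succ T hn1)
    by_cases hr0 : r = 0
    · rw [hr, hr0, zero_smul]
    · exact absurd (eq_zero_of_lie_eq_smul hnil hr0 hr) hn0
  have hJm : ∀ T : g, ⁅J T, J n⁆ = J ⁅T, J n⁆ := by
    intro T
    rw [hJ.integrable, hcen, hcen, map_zero, zero_add, zero_add]
  have hmL : ∀ T : g, ⁅T, J n⁆ ∈ lcSub g 1 ⊓ (lcSub g 1).map J := by
    intro T
    refine ⟨lie_mem_lowerCentralSeries_one _ _, ⁅-J T, J n⁆, lie_mem_lowerCentralSeries_one _ _, ?_⟩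
    rw [← hJm, map_neg, hJ.sq, neg_neg]
  -- This bracket lies both in the line ℝn and in L, which meet only in 0.
  have hLm : ∀ l ∈ lcSub g 1, ⁅l, J n⁆ = 0 := by
    intro l hl
    obtain ⟨r, hr⟩ := h2n _ (lie_mem_lcSub_succ' (J n) hl)
    have h3 := hmL l
    rw [hr] at h3
    by_cases hr0 : r = 0
    · rw [hr, hr0, zero_smul]
    · exact absurd ((Submodule.smul_mem_iff _ hr0).1 h3) hnL
  obtain ⟨T, hT⟩ : ∃ T, T ∉ lcSub g 1 ⊔ (lcSub g 1).map J := by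
    by_contra! hall
    exact hne (eq_top_iff.2 fun X _ => hall X)
  have hdecT : ∀ X, ∃ x y : ℝ, ∃ k ∈ lcSub g 1 ⊔ (lcSub g 1).map J, X = x • T + y • J T + k :=
    fun X => exists_eq_smul_add_smul_add (S' := ⊤) hJ.sq hKinv (by simp) le_top
      (by rw [hK, finrank_top, hdim]) Submodule.mem_top hT Submodule.mem_top
  have hdecK : ∀ X ∈ lcSub g 1 ⊔ (lcSub g 1).map J, ∃ x y : ℝ,
      ∃ l ∈ lcSub g 1 ⊓ (lcSub g 1).map J, X = x • n + y • J n + l :=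
    fun X hX => exists_eq_smul_add_smul_add hJ.sq hLinv hKinv hLle (by omega)
      (Submodule.mem_sup_left hn1) hnL hX
  -- Otherwise Jn is central, [g, K] ⊆ ℝn, and [g, g] is spanned by n and [T, JT], which is too
  -- small.
  have hb0 : ⁅T, J n⁆ ≠ 0 := by
    intro h0
    have hm : ∀ X : g, ⁅X, J n⁆ = 0 := by
      intro X
      obtain ⟨x, y, k, hk, rfl⟩ := hdecT X
      obtain ⟨x', y', l, hl, rfl⟩ := hdecK k hk
      have hnm : ⁅n, J n⁆ = 0 := hLm n hn1
      simp only [add_lie, smul_lie, lie_self, hJm, h0, hnm, hLm l hl.1, map_zero, smul_zero,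
        add_zero]
    have hKn : ∀ X : g, ∀ Y ∈ lcSub g 1 ⊔ (lcSub g 1).map J, ∃ r : ℝ, ⁅X, Y⁆ = r • n := by
      intro X Y hY
      obtain ⟨x', y', l, hl, rfl⟩ := hdecK Y hY
      obtain ⟨r, hr⟩ := h2n _ (lie_mem_lcSub_succ X hl.1)
      exact ⟨r, by simp only [lie_add, lie_smul, hm, hcen, hr, smul_zero, zero_add]⟩
    have hle : lcSub g 1 ≤ Submodule.span ℝ {n, ⁅T, J T⁆} := by
      refine (lowerCentralSeries_succ_le_iff 0 _).2 fun X Y _ => ?_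
      obtain ⟨x', y', k', hk', rfl⟩ := hdecT Y
      obtain ⟨r', hr'⟩ := hKn X k' hk'
      obtain ⟨x, y, k, hk, rfl⟩ := hdecT X
      obtain ⟨r, hr⟩ := hKn (x' • T + y' • J T) k hk
      refine Submodule.mem_span_pair.2 ⟨r' - r, x * y' - y * x', ?_⟩
      rw [lie_add, hr', add_lie _ k, ← lie_skew k (x' • T + y' • J T), hr]
      simp only [add_lie, lie_add, smul_lie, lie_smul, lie_self, ← lie_skew (J T) T]
      module
    have h3 := Submodule.finrank_mono hle
    have h4 : finrank ℝ (Submodule.span ℝ {n, ⁅T, J T⁆}) ≤ 2 := by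
      classical
      refine (finrank_span_le_card _).trans ?_
      simpa using Finset.card_le_two
    omega
  have hdecL : ∀ X ∈ lcSub g 1 ⊓ (lcSub g 1).map J, ∃ x y : ℝ,
      X = x • ⁅T, J n⁆ + y • J ⁅T, J n⁆ := by
    intro X hX
    obtain ⟨x, y, s, hs, rfl⟩ := exists_eq_smul_add_smul_add (S := ⊥) hJ.sq (by simp) hLinv bot_le
      (by rw [hL, finrank_bot]) (hmL T) (by simpa using hb0) hX
    rw [Submodule.mem_bot] at hs
    exact ⟨x, y, by rw [hs, add_zero]⟩
  have hb4 := (hmL T).1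
  have hb5 := (hLinv _ (hmL T)).1
  obtain ⟨α, l, hl, h01⟩ := hdec1 _ (lie_mem_lowerCentralSeries_one T (J T))
  obtain ⟨β, γ, rfl⟩ := hdecL l hl
  obtain ⟨c, h03⟩ := h2n _ (lie_mem_lcSub_succ T hb4)
  obtain ⟨c', h14⟩ := h2n _ (lie_mem_lcSub_succ (J T) hb5)
  obtain ⟨u, h04⟩ := h2n _ (lie_mem_lcSub_succ T hb5)
  obtain ⟨v, h13⟩ := h2n _ (lie_mem_lcSub_succ (J T) hb4)
  -- Integrability gives c' = c and v = −u, by independence of n and Jn; the Jacobi identity for T,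
  -- JT, Jn gives u = v. Hence u = v = 0.
  have hint := hJ.integrable T ⁅T, J n⁆
  rw [h14, h03, h13, h04, add_assoc, ← map_add, ← add_smul, map_smul] at hint
  obtain ⟨hcc, hvu⟩ : c' - c = 0 ∧ v + u = 0 := by
    have h3 : (c' - c) • n + (-(v + u)) • J n ∈ (⊥ : Submodule ℝ g) := by
      rw [Submodule.mem_bot, sub_smul, hint]
      module
    have := smul_add_smul_mem hJ.sq (S := ⊥) (by simp) (by simpa using hn0) h3
    exact ⟨this.1, by linarith [this.2]⟩
  have hjac := leibniz_lie T (J T) (J n)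
  rw [hLm _ (lie_mem_lowerCentralSeries_one T (J T)), hJm, h04, h13, zero_add] at hjac
  have huv : u = v := smul_left_injective ℝ hn0 hjac
  have hu0 : u = 0 := by linarith
  have hv0 : v = 0 := by linarith
  have hc' : c' = c := by linarith
  rw [hu0, zero_smul] at h04
  rw [hv0, zero_smul] at h13
  rw [hc'] at h14
  have h23 : ⁅J n, ⁅T, J n⁆⁆ = 0 := by rw [← lie_skew, hLm _ hb4, neg_zero]
  have h24 : ⁅J n, J ⁅T, J n⁆⁆ = 0 := by rw [← lie_skew, hLm _ hb5, neg_zero]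
  have h34 : ⁅⁅T, J n⁆, J ⁅T, J n⁆⁆ = 0 := by
    rw [lie_lie, h24, h04, lie_zero, lie_zero, sub_zero]
  -- If c = 0, every bracket of a frame vector with n, b or Jb vanishes, so [g, [g, g]] = 0,
  -- although it contains n.
  have hc0 : c ≠ 0 := by
    intro h0
    rw [h0, zero_smul] at h03 h14
    have hbot : lcSub g 2 ≤ ⊥ := by
      refine (lowerCentralSeries_succ_le_iff 1 _).2 fun X Y hY => ?_
      rw [Submodule.mem_bot]
      obtain ⟨r, l, hl, rfl⟩ := hdec1 Y hY
      obtain ⟨p, q, rfl⟩ := hdecL l hl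
      obtain ⟨x, y, k, hk, rfl⟩ := hdecT X
      obtain ⟨x', y', l', hl', rfl⟩ := hdecK k hk
      obtain ⟨p', q', rfl⟩ := hdecL l' hl'
      have hcen' : ∀ T : g, ⁅n, T⁆ = 0 := fun T => by rw [← lie_skew, hcen, neg_zero]
      have h43 : ⁅J ⁅T, J n⁆, ⁅T, J n⁆⁆ = 0 := by rw [← lie_skew, h34, neg_zero]
      simp only [add_lie, lie_add (_ : g) (_ : g) (_ : g), smul_lie, lie_smul, lie_self, hcen,
        hcen', h03, h04, h13, h14, h23, h24, h34, h43, smul_zero, add_zero]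
    exact hn0 (by simpa using hbot hn)
  refine nonempty_equiv_of_frame hdim ![T, J T, J n, ⁅T, J n⁆, J ⁅T, J n⁆, n] ?_ hc0
    (α := α) (β := β) (γ := γ) ?_ rfl (hJm T) h03 h14 h04 h13 h23 h24 h34 hcen
  · intro X
    obtain ⟨x, y, k, hk, rfl⟩ := hdecT X
    obtain ⟨x', y', l, hl, rfl⟩ := hdecK k hk
    obtain ⟨p, q, rfl⟩ := hdecL l hl
    refine ⟨![x, y, y', p, q, x'], ?_⟩
    simp
    module
  · simp [h01]
    module

end Cases

/-! ### Prescribed coefficients and assembly of the classification. -/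

theorem block_zero_eq_I {n : Fin 9} (hn : n ≤ 4) :
    (blockRe n 0 + blockIm n 0 * Complex.I : ℂ) = Complex.I := by
  fin_cases n <;> first | exact absurd hn (by decide) | simp [blockRe, blockIm]

theorem block_two_eq_I {n : Fin 9} (hn : 5 ≤ n) :
    (blockRe n 2 + blockIm n 2 * Complex.I : ℂ) = Complex.I := by
  fin_cases n <;> first | exact absurd hn (by decide) | simp [blockRe, blockIm]

theorem exists_nonempty_equiv_listed (g : Type*) [LieRing g] [LieAlgebra ℝ g]
    (hdim : finrank ℝ g = 6) (hnil : LieRing.IsNilpotent g) (hb : firstBetti g = 3)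
    (hJ : AdmitsComplexStructure g) : ∃ n : Fin 9, Nonempty (g ≃ₗ⁅ℝ⁆ ListedAlgebra n) := by
  have : FiniteDimensional ℝ g := FiniteDimensional.of_finrank_pos (by omega)
  obtain ⟨J, hJ⟩ := hJ
  have h1 : finrank ℝ (lcSub g 1) = 3 := by
    have : finrank ℝ (lcSub g 1) + firstBetti g = finrank ℝ g :=
      finrank_lowerCentralSeries_one_add_firstBetti
    omega
  by_cases h2 : lcSub g 2 ≤ lcSub g 1 ⊓ (lcSub g 1).map J
  · exact exists_nonempty_equiv_of_lcSub_two_le hdim hnil hJ h1 h2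
  · exact ⟨8, nonempty_equiv_of_not_lcSub_two_le hdim hnil hJ h1 h2⟩

end NilpotentComplex

end

open NilpotentComplex in
theorem theorem3p2 :
    -- the classification
    (∀ (g : Type*) [LieRing g] [LieAlgebra ℝ g],
      Module.finrank ℝ g = 6 → LieRing.IsNilpotent g → firstBetti g = 3 →
      AdmitsComplexStructure g → ∃ n : Fin 9, Nonempty (g ≃ₗ⁅ℝ⁆ ListedAlgebra n)) ∧
    -- all nine algebras have the properties in question
    (∀ n : Fin 9, Module.finrank ℝ (ListedAlgebra n) = 6 ∧ LieRing.IsNilpotent (ListedAlgebra n) ∧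
      firstBetti (ListedAlgebra n) = 3 ∧ AdmitsComplexStructure (ListedAlgebra n)) ∧
    -- complex structures on the first five algebras
    (∀ n : Fin 9, n ≤ 4 → ∃ (b c : ℂ) (J : ListedAlgebra n →ₗ[ℝ] ListedAlgebra n),
      IsComplexStructure J ∧ formsOneZero J = spanL n Complex.I b c) ∧
    -- complex structures on the next three algebras
    (∀ n : Fin 9, 5 ≤ n → n ≤ 7 → ∃ (a b : ℂ) (J : ListedAlgebra n →ₗ[ℝ] ListedAlgebra n),
      IsComplexStructure J ∧ formsOneZero J = spanL n a b Complex.I) ∧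
    -- a complex structure on the last algebra
    (∃ J : ListedAlgebra 8 →ₗ[ℝ] ListedAlgebra 8,
      IsComplexStructure J ∧ formsOneZero J = spanM 8) := by
  refine ⟨exists_nonempty_equiv_listed, fun n => ⟨finrank_listed n, isNilpotent_listed n,
    firstBetti_listed n, admitsComplexStructure_listed n⟩, fun n hn => ?_, fun n h5 h7 => ?_,
    lastJ, isComplexStructure_lastJ, formsOneZero_lastJ⟩
  · have hne : n ≠ 8 := by
      rintro rfl
      exact absurd hn (by decide)
    refine ⟨blockRe n 1 + blockIm n 1 * Complex.I, blockRe n 2 + blockIm n 2 * Complex.I, _,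
      isComplexStructure_blockJ n hne, ?_⟩
    rw [formsOneZero_blockJ n _ _ (blockIm_ne_zero n), block_zero_eq_I hn]
  · have hne : n ≠ 8 := by
      rintro rfl
      exact absurd h7 (by decide)
    refine ⟨blockRe n 0 + blockIm n 0 * Complex.I, blockRe n 1 + blockIm n 1 * Complex.I, _,
      isComplexStructure_blockJ n hne, ?_⟩
    rw [formsOneZero_blockJ n _ _ (blockIm_ne_zero n), block_two_eq_I h5]
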